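/- \textbf{Model.} A user sits at the origin of $\mathbb R^2$ and is served by a transmitter (TX) without an assisting reconfigurable surface (RIS) at a fixed location $x_0\neq 0$; put $d_{g,0}=\|x_0\|$. The other TXs form a homogeneous Poisson point process $\{X_k\}$ of density $\lambda_t>0$. Independently of each other, each of them has, with probability $p\in[0,1]$ (event $b_k=1$), an assisting RIS with $N$ elements, located uniformly on the circle of radius $d_0>0$ around the TX; otherwise $b_k=0$. The path loss of a direct link of length $d$ is $C_d d^{-\alpha}$, that of a reflected link whose RIS–user part has length $d$ is $C_r(d_0d)^{-\alpha}$, with $C_d,C_r>0$ and $\alpha>2$. Put $\eta_{g,0}=C_d d_{g,0}^{-\alpha}$, $\eta_{g,k}=C_d\|X_k\|^{-\alpha}$, $\eta_{h,k}=C_r(d_0 d_{r,k})^{-\alpha}$, where $d_{r,k}$ is the distance from the RIS of the $k$-th TX to the user, $\gamma_t=P/\sigma_0^2$ (transmit power over noise power, both positive), and $e_1=C_d+NC_rd_0^{-\alpha}$. The serving channel satisfies $|g_0|\sim\mathrm{Rayleigh}(\sqrt2/2)$, the direct interfering channels are $g_k\sim\mathcal{CN}(0,1)$, and the reflected channels are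 $Z_k=\sum_{n=1}^N|h_{k,n}||r_{k,n}|e^{j\theta_{k,n}}$ with $|h_{k,n}|\sim\mathrm{Nakagami}(m_h,1)$, $|r_{k,n}|\sim\mathrm{Nakagami}(m_r,1)$ ($m_h,m_r>0$) and $\theta_{k,n}$ uniform on $[-\pi,\pi)$; all these variables are independent. The signal power, the interference power and the SINR are $$S_0^*=\eta_{g,0}|g_0|^2,\qquad I=\sum_k\Big(b_k\big|\sqrt{\eta_{g,k}}\,g_k+\sqrt{\eta_{h,k}}\,Z_k\big|^2+(1-b_k)\big|\sqrt{\eta_{g,k}}\,g_k\big|^2\Big),\qquad \gamma_0^*=\frac{S_0^*}{I+\gamma_t^{-1}}.$$ By the \emph{approximate model} we mean the same model with $Z_k$ replaced by an independent $\mathcal{CN}(0,N)$ variable and $d_{r,k}$ replaced by $\|X_k\|$. \textbf{Proposition.} Let $\bar\gamma\ge 0$. (1) In the model and also in the approximate model, $I<\infty$ almost surely and $$\mathbb P(\gamma_0^*>\bar\gamma)=\exp\!\Big(-\frac{\bar\gamma\,\gamma_t^{-1}}{\eta_{g,0}}\Big)\,\mathbb E\Big[e^{-sI}\Big]_{s=\bar\gamma/\eta_{g,0}}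 .$$ (2) In the approximate model, $$\mathbb P(\gamma_0^*>\bar\gamma)=\exp\!\left(-\frac{\bar\gamma}{\eta_{g,0}}\gamma_t^{-1}-\frac{2\pi^2\lambda_t\,p\,\csc\!\big(\tfrac{2\pi}{\alpha}\big)\big(\tfrac{e_1\bar\gamma}{\eta_{g,0}}\big)^{2/\alpha}}{\alpha}-\frac{2\pi^2\lambda_t(1-p)\csc\!\big(\tfrac{2\pi}{\alpha}\big)\big(\tfrac{C_d\bar\gamma}{\eta_{g,0}}\big)^{2/\alpha}}{\alpha}\right).$$ (3) In the approximate model, if $\bar\gamma>0$, the coverage probability $\mathbb P(\gamma_0^*>\bar\gamma)$ is strictly decreasing in $\lambda_t$, the other parameters being fixed. -/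

import Mathlib

open MeasureTheory ProbabilityTheory
open scoped ENNReal NNReal

noncomputable section

namespace RIS

/-- The plane in which transmitters (TXs) and surfaces (RISs) live; the typical user sits at `0`. -/
abbrev Plane : Type := EuclideanSpace ℝ (Fin 2)

/-! ### Probability laws -/

/-- The circularly symmetric complex Gaussian law `CN(0, v)`: independent real and imaginary
parts, each `N(0, v / 2)`. -/
def complexGaussian (v : ℝ≥0) : Measure ℂ :=
  ((gaussianReal 0 (v / 2)).prod (gaussianReal 0 (v / 2))).map
    (fun q : ℝ × ℝ => (q.1 : ℂ) + (q.2 : ℂ) * Complex.I)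

/-- The Rayleigh law with scale parameter `σ`. -/
def rayleighMeasure (σ : ℝ) : Measure ℝ :=
  volume.withDensity (fun x =>
    ENNReal.ofReal (if 0 < x then x / σ ^ 2 * Real.exp (-x ^ 2 / (2 * σ ^ 2)) else 0))

/-- The Nakagami law with shape parameter `m` and spread (second moment) `w`. -/
def nakagamiMeasure (m w : ℝ) : Measure ℝ :=
  volume.withDensity (fun x =>
    ENNReal.ofReal (if 0 < x then
      2 * m ^ m / (Real.Gamma m * w ^ m) * x ^ (2 * m - 1) * Real.exp (-m * x ^ 2 / w) else 0))

/-- The uniform law on `[-π, π)`. -/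
def uniformAngle : Measure ℝ := cond volume (Set.Ico (-Real.pi) Real.pi)

/-- The law of a Boolean that is `true` with probability `p`. -/
def coin (p : ℝ) : Measure Bool :=
  ENNReal.ofReal p • Measure.dirac true + ENNReal.ofReal (1 - p) • Measure.dirac false

/-- The law of `∑ₙ |hₙ| |rₙ| exp (i θₙ)` (`n` runs over the `N` elements of a surface), where
`|hₙ| ~ Nakagami(mh, 1)`, `|rₙ| ~ Nakagami(mr, 1)`, `θₙ` is uniform on `[-π, π)`, and all these
variables are independent. -/
def reflectedLaw (N : ℕ) (mh mr : ℝ) : Measure ℂ :=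
  (Measure.pi fun _ : Fin N =>
      (nakagamiMeasure mh 1).prod ((nakagamiMeasure mr 1).prod uniformAngle)).map
    (fun q : Fin N → ℝ × ℝ × ℝ =>
      ∑ n, (((q n).1 * (q n).2.1 : ℝ) : ℂ) * Complex.exp (((q n).2.2 : ℂ) * Complex.I))

/-! ### Homogeneous Poisson point process -/

/-- The points `X 0, X 1, …` form a homogeneous Poisson point process with density `lam` in the
plane: the number of points in a set of finite area is Poisson with mean `lam` times the area, and
the numbers of points in disjoint sets are independent. -/
structure IsHPPP {Ω : Type*} [MeasurableSpace Ω] (μ : Measure Ω) (lam : ℝ)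
    (X : ℕ → Ω → Plane) : Prop where
  measurable : ∀ k, Measurable (X k)
  count_law : ∀ B : Set Plane, MeasurableSet B → volume B ≠ ∞ → ∀ n : ℕ,
    μ {ω | {k | X k ω ∈ B}.encard = n} = poissonMeasure (lam * volume.real B).toNNReal {n}
  count_indep : ∀ (m : ℕ) (B : Fin m → Set Plane), (∀ i, MeasurableSet (B i)) →
    (∀ i, volume (B i) ≠ ∞) → Pairwise (fun i j => Disjoint (B i) (B j)) →
    iIndepFun (fun i ω => {k | X k ω ∈ B i}.encard) μ

/-! ### The network -/

/-- The deterministic parameters of the system, except for the density of TXs. -/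
structure Params where
  /-- probability that a TX has an assisting RIS -/
  p : ℝ
  /-- distance between a TX and its RIS -/
  d0 : ℝ
  /-- number of elements of each RIS -/
  N : ℕ
  /-- path loss per unit distance of the direct link -/
  Cd : ℝ
  /-- path loss per unit distance of the reflected link -/
  Cr : ℝ
  /-- path loss exponent -/
  α : ℝ
  /-- Nakagami shape parameter of the TX-RIS channels -/
  mh : ℝ
  /-- Nakagami shape parameter of the RIS-user channels -/
  mr : ℝ
  /-- transmit power of each TX -/
  P : ℝ
  /-- noise power -/
  noise : ℝ
  /-- fixed location of the TX that serves the typical user -/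
  x0 : Plane
  p_nonneg : 0 ≤ p
  p_le_one : p ≤ 1
  d0_pos : 0 < d0
  Cd_pos : 0 < Cd
  Cr_pos : 0 < Cr
  two_lt_α : 2 < α
  mh_pos : 0 < mh
  mr_pos : 0 < mr
  P_pos : 0 < P
  noise_pos : 0 < noise
  x0_ne_zero : x0 ≠ 0

namespace Params

variable (par : Params)

/-- Transmit signal-to-noise ratio `γ_t = P / σ₀²`. -/
def gammaT : ℝ := par.P / par.noise

/-- Path loss of a direct link of length `d`. -/
def etaG (d : ℝ) : ℝ := par.Cd * d ^ (-par.α)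

/-- Path loss of a reflected path whose RIS-user part has length `d`. -/
def etaH (d : ℝ) : ℝ := par.Cr * (par.d0 * d) ^ (-par.α)

/-- Path loss `η_{g,0}` of the serving link. -/
def etaG0 : ℝ := par.etaG ‖par.x0‖

/-- `e₁ = C_d + N C_r d₀^{-α}`. -/
def e1 : ℝ := par.Cd + par.N * par.Cr * par.d0 ^ (-par.α)

end Params

/-- The interfering TXs with their clusters and channels, and the serving channel, for a user that
is served by a TX at a fixed location. The interfering TXs sit at `X k` and form a homogeneous
Poisson process with density `lam`. Independently of the locations and of each other they carry
i.i.d. marks: `b k` tells whether the TX has a RIS, `ψ k` is the direction of that RIS as seen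
from the TX, `g k ~ CN(0, 1)` is the direct channel, and `Z k`, with law `ν`, is the sum over the
RIS elements of the reflected channels. All these are independent of the serving channel `g0`. -/
structure Network (par : Params) (lam : ℝ) (ν : Measure ℂ)
    {Ω : Type*} [MeasurableSpace Ω] (μ : Measure Ω) where
  X : ℕ → Ω → Plane
  b : ℕ → Ω → Bool
  ψ : ℕ → Ω → ℝ
  g : ℕ → Ω → ℂ
  Z : ℕ → Ω → ℂ
  g0 : Ω → ℂ
  X_hppp : IsHPPP μ lam X
  measurable_b : ∀ k, Measurable (b k)
  measurable_ψ : ∀ k, Measurable (ψ k)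
  measurable_g : ∀ k, Measurable (g k)
  measurable_Z : ∀ k, Measurable (Z k)
  measurable_g0 : Measurable g0
  /-- the components of a mark are independent, with the laws described above -/
  mark_law : ∀ k, μ.map (fun ω => (b k ω, ψ k ω, g k ω, Z k ω)) =
    (coin par.p).prod (uniformAngle.prod ((complexGaussian 1).prod ν))
  mark_indep : iIndepFun (fun k ω => (b k ω, ψ k ω, g k ω, Z k ω)) μ
  g0_law : μ.map (fun ω => ‖g0 ω‖) = rayleighMeasure (Real.sqrt 2 / 2)
  indep_g0 : IndepFun g0 (fun ω k => (b k ω, ψ k ω, g k ω, Z k ω)) μ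
  indep_X : IndepFun (fun ω k => X k ω)
    (fun ω => (g0 ω, fun k => (b k ω, ψ k ω, g k ω, Z k ω))) μ

namespace Network

variable {par : Params} {lam : ℝ} {ν : Measure ℂ} {Ω : Type*} [MeasurableSpace Ω] {μ : Measure Ω}
variable (W : Network par lam ν μ)

/-- Distance between the `k`-th interfering TX and the user. -/
def distTX (k : ℕ) (ω : Ω) : ℝ := ‖W.X k ω‖

/-- Distance between the RIS of the `k`-th interfering TX and the user. -/
def distRIS (k : ℕ) (ω : Ω) : ℝ :=
  ‖W.X k ω + par.d0 • !₂[Real.cos (W.ψ k ω), Real.sin (W.ψ k ω)]‖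

/-- Interference power when the RIS-user distances are taken to be `dR`: the sum, over the
interfering TXs, of `|√η_g g + √η_h Z|²` (TX with RIS) or `|√η_g g|²` (TX without RIS). -/
def interference (dR : ℕ → Ω → ℝ) (ω : Ω) : ℝ≥0∞ :=
  ∑' k, ENNReal.ofReal
    (if W.b k ω then
      ‖(Real.sqrt (par.etaG (W.distTX k ω)) : ℂ) * W.g k ω
        + (Real.sqrt (par.etaH (dR k ω)) : ℂ) * W.Z k ω‖ ^ 2
    else ‖(Real.sqrt (par.etaG (W.distTX k ω)) : ℂ) * W.g k ω‖ ^ 2)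

/-- Power of the desired signal from a TX without RIS. -/
def signal (ω : Ω) : ℝ := par.etaG0 * ‖W.g0 ω‖ ^ 2

/-- The signal-to-interference-plus-noise ratio `S / (I + γ_t⁻¹)` without assisting RIS. -/
def sinr (dR : ℕ → Ω → ℝ) (ω : Ω) : ℝ≥0∞ :=
  ENNReal.ofReal (W.signal ω) / (W.interference dR ω + ENNReal.ofReal par.gammaT⁻¹)

/-- Coverage probability at the threshold `t`. -/
def coverage (dR : ℕ → Ω → ℝ) (t : ℝ) : ℝ :=
  μ.real {ω | ENNReal.ofReal t < W.sinr dR ω}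

/-- Laplace transform of the interference power (used for an almost surely finite one). -/
def laplace (dR : ℕ → Ω → ℝ) (s : ℝ) : ℝ :=
  ∫ ω, Real.exp (-s * (W.interference dR ω).toReal) ∂μ

end Network

end RIS

end

/-! ### The function `e^{-x}` on `[0, ∞]`. -/

namespace RIS

/-! Since `|g₀|²` is exponential with mean one and independent of `I`, conditioning on `I < ∞` gives
`P(S > t (I + γ_t⁻¹)) = E exp(-s (I + γ_t⁻¹))` with `s = t / η_{g,0}`. Pulling out the noise factor
is the factorization `coverage_eq`.

The Laplace transform of `I` comes from the functional of a marked Poisson process, `E exp(-∑ f(X_k,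
M_k)) = exp(-λ ∫ (1 - E e^{-f(x, M)}) dx)` (`IsHPPP.lintegral_expNeg_tsum_marked`). It holds for
every measurable `f` with values in `[0, ∞]`, so it also yields finiteness of `I`: `P(I < ∞) ≥ E
e^{-sI}` for `s > 0`, and the exponent tends to `0` with `s`. A first-moment argument would fail,
because the path loss singularity at the user makes `E I` infinite. Near the user the bound `1 - E
e^{-f} ≤ 1` suffices; far away, second moments of the fading and `α > 2` do.

In the approximate model the amplitude received from distance `r` is complex Gaussian with variance
`c r^{-α}`, where `c = e₁` or `c = C_d`. The power is then exponential and `1 - E e^{-sW} = c s /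
(r^α + c s)`. Integrating over the plane gives the cosecant, through Euler's reflection formula. The
exponent is affine in `λ`, with negative slope for `t > 0`, whence the monotonicity.

Working with `expNeg` on `[0, ∞]` makes every integral exist before finiteness of `I` is known. -/

/-- The function `x ↦ exp (-x)` on `[0, ∞]`, with `exp (-∞) = 0`. -/
noncomputable def expNeg (x : ℝ≥0∞) : ℝ≥0∞ := EReal.exp (-(x : EReal))

@[simp] lemma expNeg_zero : expNeg 0 = 1 := by simp [expNeg]

@[simp] lemma expNeg_top : expNeg ⊤ = 0 := by simp [expNeg]

lemma expNeg_add (x y : ℝ≥0∞) : expNeg (x + y) = expNeg x * expNeg y := by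
  unfold expNeg
  rw [← EReal.exp_add, EReal.coe_ennreal_add, EReal.neg_add, sub_eq_add_neg]
  · exact Or.inl (EReal.coe_ennreal_ne_bot x)
  · exact Or.inr (EReal.coe_ennreal_ne_bot y)

lemma expNeg_ofReal {x : ℝ} (hx : 0 ≤ x) : expNeg (ENNReal.ofReal x) = ENNReal.ofReal (Real.exp (-x)) := by
  unfold expNeg
  rw [EReal.coe_ennreal_ofReal, max_eq_left hx, ← EReal.coe_neg, EReal.exp_coe]

lemma expNeg_of_ne_top {x : ℝ≥0∞} (hx : x ≠ ⊤) :
    expNeg x = ENNReal.ofReal (Real.exp (-x.toReal)) := by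
  conv_lhs => rw [← ENNReal.ofReal_toReal hx]
  exact expNeg_ofReal ENNReal.toReal_nonneg

lemma expNeg_le_one (x : ℝ≥0∞) : expNeg x ≤ 1 := by
  simp [expNeg, EReal.exp_le_one_iff, EReal.coe_ennreal_nonneg]

lemma expNeg_ne_top (x : ℝ≥0∞) : expNeg x ≠ ⊤ :=
  ne_top_of_le_ne_top ENNReal.one_ne_top (expNeg_le_one x)

lemma one_le_add_expNeg (x : ℝ≥0∞) : 1 ≤ x + expNeg x := by
  by_cases hx : x = ⊤
  · simp [hx]
  · rw [expNeg_of_ne_top hx]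
    nth_rw 1 [← ENNReal.ofReal_toReal hx]
    rw [← ENNReal.ofReal_add ENNReal.toReal_nonneg (Real.exp_pos _).le, ENNReal.one_le_ofReal]
    linarith [Real.add_one_le_exp (-x.toReal)]

lemma continuous_expNeg : Continuous expNeg :=
  EReal.expHomeomorph.continuous.comp (continuous_neg.comp continuous_coe_ennreal_ereal)

@[fun_prop] lemma measurable_expNeg : Measurable expNeg := continuous_expNeg.measurable

lemma antitone_expNeg : Antitone expNeg := fun _ _ h =>
  EReal.exp_monotone (EReal.neg_le_neg_iff.2 (EReal.coe_ennreal_le_coe_ennreal_iff.2 h))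

lemma expNeg_sum {ι : Type*} (s : Finset ι) (f : ι → ℝ≥0∞) :
    expNeg (∑ i ∈ s, f i) = ∏ i ∈ s, expNeg (f i) := by
  classical
  induction s using Finset.induction_on with
  | empty => simp
  | insert a s ha ih => rw [Finset.sum_insert ha, Finset.prod_insert ha, expNeg_add, ih]

/-- Lets a product of factors in `[0, 1]` over the points be read as `expNeg` of a sum, which
reduces the marked functional to the unmarked one. -/
lemma expNeg_neg_log {φ : ℝ≥0∞} (hφ : φ ≤ 1) :
    expNeg (-ENNReal.log φ).toENNReal = φ := by
  unfold expNeg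
  rw [EReal.coe_toENNReal]
  · simp
  · rw [EReal.neg_nonneg]; simpa using hφ

lemma tendsto_expNeg_sum (f : ℕ → ℝ≥0∞) :
    Filter.Tendsto (fun n => expNeg (∑ k ∈ Finset.range n, f k)) Filter.atTop
      (nhds (expNeg (∑' k, f k))) :=
  (continuous_expNeg.tendsto _).comp ENNReal.summable.hasSum.tendsto_sum_nat

/-- Dominated convergence for functions of the form `expNeg ∘ F n`. -/
lemma tendsto_lintegral_expNeg {Ω : Type*} [MeasurableSpace Ω] (μ : Measure Ω) [IsFiniteMeasure μ]
    {F : ℕ → Ω → ℝ≥0∞} {G : Ω → ℝ≥0∞} (hF : ∀ n, Measurable (F n))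
    (h : ∀ ω, Filter.Tendsto (fun n => F n ω) Filter.atTop (nhds (G ω))) :
    Filter.Tendsto (fun n => ∫⁻ ω, expNeg (F n ω) ∂μ) Filter.atTop
      (nhds (∫⁻ ω, expNeg (G ω) ∂μ)) := by
  refine tendsto_lintegral_of_dominated_convergence (fun _ => 1)
    (fun n => measurable_expNeg.comp (hF n)) (fun n => .of_forall fun ω => expNeg_le_one _) ?_ ?_
  · simp
  · exact .of_forall fun ω => (continuous_expNeg.tendsto _).comp (h ω)

/-! ### The Laplace functional of a Poisson process -/

section Laplace

variable {Ω : Type*} [MeasurableSpace Ω] {μ : Measure Ω}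

/-- Generating function of the Poisson law, `E q^K = e^{-r(1 - q)}` at `q = e^{-a}`. As `a ≠ 0`, the
event `K = ∞` contributes nothing, so its probability need not be known. -/
lemma lintegral_expNeg_poisson {r : ℝ≥0} {K : Ω → ℕ∞} (hK : Measurable K)
    (h : ∀ n : ℕ, μ {ω | K ω = n} = poissonMeasure r {n}) {a : ℝ≥0∞} (ha : a ≠ 0) :
    ∫⁻ ω, expNeg (a * K ω) ∂μ = expNeg (r * (1 - expNeg a)) := by
  have hq : expNeg a ≠ ⊤ := expNeg_ne_top a
  obtain ⟨q, hq'⟩ : ∃ q : ℝ≥0, expNeg a = q := ⟨_, (ENNReal.coe_toNNReal hq).symm⟩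
  have hq1 : (q : ℝ) ≤ 1 := by
    have := expNeg_le_one a
    rw [hq'] at this; exact_mod_cast this
  have hnat : ∀ n : ℕ, expNeg (a * n) = expNeg a ^ n := by
    intro n
    have := expNeg_sum (Finset.range n) (fun _ => a)
    simpa [mul_comm] using this
  have hpt : ∀ ω, expNeg (a * K ω) =
      ∑' n : ℕ, Set.indicator {ω | K ω = n} (fun _ => expNeg a ^ n) ω := by
    intro ω
    by_cases hω : K ω = ⊤
    · simp [hω, ENNReal.mul_top ha, Set.indicator]
    · obtain ⟨m, hm⟩ := ENat.ne_top_iff_exists.1 hω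
      rw [tsum_eq_single m]
      · simp [← hm, hnat]
      · intro n hn
        simp [← hm, hn.symm]
  have hms : ∀ n : ℕ, MeasurableSet {ω | K ω = n} := fun n => hK (measurableSet_singleton _)
  simp_rw [hpt]
  rw [lintegral_tsum (fun n => (measurable_const.indicator (hms n)).aemeasurable)]
  simp_rw [lintegral_indicator_const (hms _), h, poissonMeasure_singleton]
  have h1 : ((r : ℝ≥0∞) * (1 - expNeg a)) = ENNReal.ofReal (r * (1 - q)) := by
    rw [hq', ENNReal.ofReal_mul r.coe_nonneg, ENNReal.ofReal_sub _ q.coe_nonneg]; simp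
  rw [h1, expNeg_ofReal (mul_nonneg r.coe_nonneg (sub_nonneg.2 hq1))]
  have h2 : ∀ n : ℕ, expNeg a ^ n * ENNReal.ofReal (Real.exp (-r) * r ^ n / (n.factorial : ℝ)) =
      ENNReal.ofReal (Real.exp (-r) * ((q * r) ^ n / (n.factorial : ℝ))) := by
    intro n
    rw [hq', ← ENNReal.ofReal_coe_nnreal, ← ENNReal.ofReal_pow q.coe_nonneg, ← ENNReal.ofReal_mul (by positivity)]
    congr 1
    rw [mul_pow]; ring
  simp_rw [h2]
  have hs := (NormedSpace.expSeries_div_hasSum_exp ((q : ℝ) * r)).mul_left (Real.exp (-r))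
  rw [← ENNReal.ofReal_tsum_of_nonneg (fun n => by positivity) hs.summable, hs.tsum_eq,
    ← Real.exp_eq_exp_ℝ, ← Real.exp_add]
  congr 2; ring

variable {lam : ℝ} {X : ℕ → Ω → Plane}

lemma tsum_indicator_eq_encard (B : Set Plane) (x : ℕ → Plane) :
    ∑' k, B.indicator (fun _ => (1 : ℝ≥0∞)) (x k) = ({k | x k ∈ B}.encard : ℝ≥0∞) := by
  rw [← ENNReal.tsum_set_one, tsum_subtype {k | x k ∈ B} (fun _ => (1 : ℝ≥0∞))]
  rfl

lemma IsHPPP.measurable_encard (hX : IsHPPP μ lam X) {B : Set Plane} (hB : MeasurableSet B) :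
    Measurable fun ω => {k | X k ω ∈ B}.encard := by
  have h : Measurable fun ω => ({k | X k ω ∈ B}.encard : ℝ≥0∞) := by
    simp_rw [← tsum_indicator_eq_encard B (fun k => X k _)]
    exact Measurable.tsum fun k =>
      (measurable_const.indicator hB).comp (hX.measurable k)
  refine measurable_to_countable' fun n => ?_
  have : (fun ω => {k | X k ω ∈ B}.encard) ⁻¹' {n} =
      (fun ω => ({k | X k ω ∈ B}.encard : ℝ≥0∞)) ⁻¹' {(n : ℝ≥0∞)} := by
    ext ω; simp
  rw [this]
  exact h (measurableSet_singleton _)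

/-- The sum over the points is a finite combination of the counts in the level sets of `f`. These
sets are disjoint, so the counts are independent Poisson variables and the transform factorizes. -/
lemma IsHPPP.lintegral_expNeg_tsum_simpleFunc (hX : IsHPPP μ lam X) (hlam : 0 ≤ lam)
    (f : SimpleFunc Plane ℝ≥0∞) (hf : ∀ a ≠ 0, volume (f ⁻¹' {a}) ≠ ∞) :
    ∫⁻ ω, expNeg (∑' k, f (X k ω)) ∂μ =
      expNeg (ENNReal.ofReal lam * ∫⁻ x, (1 - expNeg (f x))) := by
  classical
  -- The value `0` is dropped: its level set may have infinite area, and it adds nothing to the sum.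
  set s : Finset ℝ≥0∞ := f.range.filter (· ≠ 0) with hs
  have hs0 : ∀ a ∈ s, a ≠ 0 := fun a ha => (Finset.mem_filter.1 ha).2
  have hfx : ∀ x, f x = ∑ a ∈ s, a * (f ⁻¹' {a}).indicator (fun _ => (1 : ℝ≥0∞)) x := by
    intro x
    by_cases hx : f x = 0
    · rw [Finset.sum_eq_zero, hx]
      intro a ha
      have : x ∉ f ⁻¹' {a} := fun h => hs0 a ha (by rw [← hx]; exact h.symm)
      simp [this]
    · rw [Finset.sum_eq_single (f x)]
      · simp
      · intro b _ hb
        have : x ∉ f ⁻¹' {b} := fun h => hb h.symm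
        simp [this]
      · intro h
        exact absurd (Finset.mem_filter.2 ⟨f.mem_range_self x, hx⟩) h
  have hsum : ∀ ω, ∑' k, f (X k ω) =
      ∑ a ∈ s, a * ({k | X k ω ∈ f ⁻¹' {a}}.encard : ℝ≥0∞) := by
    intro ω
    simp_rw [← tsum_indicator_eq_encard _ (fun k => X k ω), ← ENNReal.tsum_mul_left]
    rw [← Summable.tsum_finsetSum (fun _ _ => ENNReal.summable)]
    exact tsum_congr fun k => hfx _
  -- `count_indep` speaks of families indexed by `Fin m`, so the values are enumerated.
  let e : Fin s.card ≃ s := s.equivFin.symm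
  have hind : iIndepFun (fun (i : Fin s.card) ω => expNeg ((e i : ℝ≥0∞) *
      ({k | X k ω ∈ f ⁻¹' {(e i : ℝ≥0∞)}}.encard : ℝ≥0∞))) μ := by
    have := hX.count_indep s.card (fun i => f ⁻¹' {(e i : ℝ≥0∞)})
      (fun i => f.measurableSet_fiber _) (fun i => hf _ (hs0 _ (e i).2)) ?_
    · exact this.comp (fun i (n : ℕ∞) => expNeg ((e i : ℝ≥0∞) * (n : ℝ≥0∞)))
        (fun i => .of_discrete)
    · intro i j hij
      refine Set.disjoint_left.2 fun x hx hx' => hij ?_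
      apply e.injective
      apply Subtype.ext
      exact (show f x = e i from hx).symm.trans hx'
  have hmeas : ∀ a : ℝ≥0∞, Measurable fun ω => expNeg (a *
      ({k | X k ω ∈ f ⁻¹' {a}}.encard : ℝ≥0∞)) := fun a =>
    (Measurable.of_discrete (f := fun n : ℕ∞ => expNeg (a * (n : ℝ≥0∞)))).comp
      (hX.measurable_encard (f.measurableSet_fiber a))
  have hcell : ∀ a ∈ s, ∫⁻ ω, expNeg (a * ({k | X k ω ∈ f ⁻¹' {a}}.encard : ℝ≥0∞)) ∂μ =
      expNeg (ENNReal.ofReal lam * volume (f ⁻¹' {a}) * (1 - expNeg a)) := by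
    intro a ha
    rw [lintegral_expNeg_poisson (hX.measurable_encard (f.measurableSet_fiber a))
      (hX.count_law _ (f.measurableSet_fiber a) (hf a (hs0 a ha))) (hs0 a ha)]
    congr 2
    rw [← ENNReal.ofReal, ENNReal.ofReal_mul hlam, ofReal_measureReal (hf a (hs0 a ha))]
  simp_rw [hsum, expNeg_sum]
  have h1 : ∀ ω, ∏ a ∈ s, expNeg (a * ({k | X k ω ∈ f ⁻¹' {a}}.encard : ℝ≥0∞)) =
      ∏ i : Fin s.card, expNeg ((e i : ℝ≥0∞) *
        ({k | X k ω ∈ f ⁻¹' {(e i : ℝ≥0∞)}}.encard : ℝ≥0∞)) := by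
    intro ω
    rw [← Finset.prod_coe_sort s]
    exact (e.prod_comp (fun a : s => expNeg ((a : ℝ≥0∞) *
      ({k | X k ω ∈ f ⁻¹' {(a : ℝ≥0∞)}}.encard : ℝ≥0∞)))).symm
  simp_rw [h1]
  rw [lintegral_prod_eq_prod_lintegral_of_indepFun Finset.univ _ hind (fun i => hmeas _)]
  rw [e.prod_comp (fun a : s => ∫⁻ ω, expNeg ((a : ℝ≥0∞) *
    ({k | X k ω ∈ f ⁻¹' {(a : ℝ≥0∞)}}.encard : ℝ≥0∞)) ∂μ)]
  rw [Finset.prod_coe_sort s (fun a => ∫⁻ ω, expNeg (a *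
    ({k | X k ω ∈ f ⁻¹' {a}}.encard : ℝ≥0∞)) ∂μ), Finset.prod_congr rfl hcell, ← expNeg_sum]
  congr 1
  have h2 : ∫⁻ x, (1 - expNeg (f x)) =
      (f.map fun a => 1 - expNeg a).lintegral volume := by
    rw [← SimpleFunc.lintegral_eq_lintegral]; rfl
  rw [h2, SimpleFunc.map_lintegral, Finset.mul_sum, hs, Finset.sum_filter]
  refine Finset.sum_congr rfl fun a _ => ?_
  by_cases ha : a = 0
  · simp [ha]
  · rw [if_pos ha]; ring

variable [IsProbabilityMeasure μ]

/-- Both sides pass to the limit along simple functions increasing to `h`. Cutting these off to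
growing balls gives their nonzero level sets finite area. -/
lemma IsHPPP.lintegral_expNeg_tsum (hX : IsHPPP μ lam X) (hlam : 0 ≤ lam)
    {h : Plane → ℝ≥0∞} (hh : Measurable h) :
    ∫⁻ ω, expNeg (∑' k, h (X k ω)) ∂μ =
      expNeg (ENNReal.ofReal lam * ∫⁻ x, (1 - expNeg (h x))) := by
  set F : ℕ → SimpleFunc Plane ℝ≥0∞ := fun n =>
    (SimpleFunc.eapprox h n).restrict (Metric.ball 0 n) with hF
  have hFx : ∀ n x, F n x =
      (Metric.ball (0 : Plane) n).indicator (SimpleFunc.eapprox h n) x := fun n x => by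
    rw [hF, SimpleFunc.restrict_apply _ measurableSet_ball]
  have hmono : Monotone F := by
    intro m n hmn x
    rw [hFx, hFx]
    refine (Set.indicator_le_indicator_of_subset
      (Metric.ball_subset_ball (by exact_mod_cast hmn)) (fun _ => zero_le) x).trans
      (Set.indicator_le_indicator (SimpleFunc.monotone_eapprox h hmn x))
  have hlim : ∀ x, Filter.Tendsto (fun n => F n x) Filter.atTop (nhds (h x)) := by
    intro x
    have h1 := SimpleFunc.tendsto_eapprox hh x
    refine h1.congr' ?_
    obtain ⟨N, hN⟩ := exists_nat_gt ‖x‖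
    filter_upwards [Filter.eventually_ge_atTop N] with n hn
    have : x ∈ Metric.ball (0 : Plane) n := by
      rw [mem_ball_zero_iff]; exact hN.trans_le (by exact_mod_cast hn)
    rw [hFx, Set.indicator_of_mem this]
  have hfin : ∀ n, ∀ a ≠ 0, volume (F n ⁻¹' {a}) ≠ ∞ := by
    intro n a ha
    refine ne_top_of_le_ne_top (measure_ball_lt_top (x := (0 : Plane)) (r := n)).ne
      (measure_mono fun x hx => ?_)
    by_contra hc
    have : F n x = a := hx
    rw [hFx, Set.indicator_of_notMem hc] at this
    exact ha this.symm
  have hL := fun n => hX.lintegral_expNeg_tsum_simpleFunc hlam (F n) (hfin n)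
  have hsum : ∀ ω, Filter.Tendsto (fun n => ∑' k, F n (X k ω)) Filter.atTop
      (nhds (∑' k, h (X k ω))) := by
    intro ω
    -- The sum over the points is an integral for the counting measure, so monotone convergence
    -- applies.
    have := lintegral_tendsto_of_tendsto_of_monotone
      (μ := Measure.count) (f := fun n k => F n (X k ω)) (F := fun k => h (X k ω)) (fun n => (measurable_of_countable _).aemeasurable)
      (.of_forall fun k m n hmn => hmono hmn _) (.of_forall fun k => hlim _)
    simp only [lintegral_count] at this
    exact this
  refine tendsto_nhds_unique (tendsto_lintegral_expNeg μ
    (fun n => Measurable.tsum fun k => (F n).measurable.comp (hX.measurable k)) hsum) ?_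
  refine Filter.Tendsto.congr (fun n => (hL n).symm) ?_
  refine (continuous_expNeg.tendsto _).comp (ENNReal.Tendsto.const_mul ?_ (Or.inr ENNReal.ofReal_ne_top))
  refine lintegral_tendsto_of_tendsto_of_monotone
    (fun n => (measurable_const.sub (measurable_expNeg.comp (F n).measurable)).aemeasurable)
    (.of_forall fun x m n hmn => tsub_le_tsub_left ?_ 1) (.of_forall fun x => ?_)
  · exact antitone_expNeg (hmono hmn x)
  · exact ENNReal.Tendsto.sub tendsto_const_nhds
      ((continuous_expNeg.tendsto _).comp (hlim x)) (Or.inl ENNReal.one_ne_top)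

/-- Laplace functional of an independently marked Poisson process. -/
lemma IsHPPP.lintegral_expNeg_tsum_marked (hX : IsHPPP μ lam X) (hlam : 0 ≤ lam)
    {E : Type*} [MeasurableSpace E] {m : Measure E} [IsProbabilityMeasure m] {M : ℕ → Ω → E}
    (hM : ∀ k, Measurable (M k)) (hlaw : ∀ k, μ.map (M k) = m) (hind : iIndepFun M μ)
    (hXM : IndepFun (fun ω k => X k ω) (fun ω k => M k ω) μ)
    {f : Plane → E → ℝ≥0∞} (hf : Measurable (Function.uncurry f)) :
    ∫⁻ ω, expNeg (∑' k, f (X k ω) (M k ω)) ∂μ =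
      expNeg (ENNReal.ofReal lam * ∫⁻ x, (1 - ∫⁻ y, expNeg (f x y) ∂m)) := by
  set φ : Plane → ℝ≥0∞ := fun x => ∫⁻ y, expNeg (f x y) ∂m with hφ
  have hφm : Measurable φ := (measurable_expNeg.comp hf).lintegral_prod_right'
  have hφ1 : ∀ x, φ x ≤ 1 := fun x =>
    (lintegral_mono fun y => expNeg_le_one _).trans (by simp)
  -- Averaging over the mark turns each point into a factor `φ (X k) = e^{-h (X k)}`; `h` may take
  -- the value `∞`.
  set h : Plane → ℝ≥0∞ := fun x => (-ENNReal.log (φ x)).toENNReal with hh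
  have hhm : Measurable h :=
    measurable_ereal_toENNReal.comp (ENNReal.measurable_log.comp hφm).neg
  have hhφ : ∀ x, expNeg (h x) = φ x := fun x => expNeg_neg_log (hφ1 x)
  have hXm : Measurable fun ω k => X k ω := measurable_pi_lambda _ hX.measurable
  have hMm : Measurable fun ω k => M k ω := measurable_pi_lambda _ hM
  have hfk : ∀ k, Measurable fun q : (ℕ → Plane) × (ℕ → E) => f (q.1 k) (q.2 k) := fun k =>
    hf.comp (f := fun q : (ℕ → Plane) × (ℕ → E) => (q.1 k, q.2 k))
      (((measurable_pi_apply k).comp measurable_fst).prodMk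
      ((measurable_pi_apply k).comp measurable_snd))
  -- With the locations frozen, independence of the marks gives the product formula for finite sums;
  -- dominated convergence gives it for the series.
  have key : ∀ x : ℕ → Plane, ∫⁻ ω, expNeg (∑' k, f (x k) (M k ω)) ∂μ =
      expNeg (∑' k, h (x k)) := by
    intro x
    have hxm : ∀ k, Measurable fun ω => f (x k) (M k ω) := fun k =>
      hf.comp (measurable_const.prodMk (hM k))
    refine tendsto_nhds_unique (tendsto_lintegral_expNeg μ
      (fun n => Finset.measurable_sum (Finset.range n) fun k _ => hxm k)
      (fun ω => ENNReal.summable.hasSum.tendsto_sum_nat)) ?_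
    refine (tendsto_expNeg_sum _).congr fun n => ?_
    simp_rw [expNeg_sum]
    have hi : iIndepFun (fun k ω => expNeg (f (x k) (M k ω))) μ :=
      hind.comp (fun k y => expNeg (f (x k) y)) fun k =>
        measurable_expNeg.comp (hf.comp (measurable_const.prodMk measurable_id))
    rw [lintegral_prod_eq_prod_lintegral_of_indepFun _ _ hi
      (fun k => measurable_expNeg.comp (hxm k))]
    refine Finset.prod_congr rfl fun k _ => ?_
    simp only [hhφ, hφ]
    rw [← hlaw k, lintegral_map _ (hM k)]
    exact measurable_expNeg.comp (hf.comp (measurable_const.prodMk measurable_id))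
  have hprob : IsProbabilityMeasure (μ.map fun ω k => X k ω) :=
    Measure.isProbabilityMeasure_map hXm.aemeasurable
  have hprob' : IsProbabilityMeasure (μ.map fun ω k => M k ω) :=
    Measure.isProbabilityMeasure_map hMm.aemeasurable
  have hG : Measurable fun q : (ℕ → Plane) × (ℕ → E) => expNeg (∑' k, f (q.1 k) (q.2 k)) :=
    measurable_expNeg.comp (Measurable.tsum hfk)
  calc ∫⁻ ω, expNeg (∑' k, f (X k ω) (M k ω)) ∂μ
      = ∫⁻ q, expNeg (∑' k, f (q.1 k) (q.2 k)) ∂(μ.map fun ω => (fun k => X k ω, fun k => M k ω)) := by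
        rw [lintegral_map hG (hXm.prodMk hMm)]
    _ = ∫⁻ x, ∫⁻ y, expNeg (∑' k, f (x k) (y k)) ∂(μ.map fun ω k => M k ω)
          ∂(μ.map fun ω k => X k ω) := by
        rw [(indepFun_iff_map_prod_eq_prod_map_map hXm.aemeasurable hMm.aemeasurable).1 hXM,
          lintegral_prod _ hG.aemeasurable]
    _ = ∫⁻ x, expNeg (∑' k, h (x k)) ∂(μ.map fun ω k => X k ω) := by
        refine lintegral_congr fun x => ?_
        have := lintegral_map (μ := μ) (hG.comp (measurable_prodMk_left (x := x))) hMm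
        rw [← key x]
        exact this
    _ = ∫⁻ ω, expNeg (∑' k, h (X k ω)) ∂μ := by
        rw [lintegral_map _ hXm]
        exact measurable_expNeg.comp (Measurable.tsum fun k => hhm.comp (measurable_pi_apply k))
    _ = _ := by
        rw [hX.lintegral_expNeg_tsum hlam hhm]
        simp only [hhφ, hφ]

end Laplace

/-! ### Laws of the marks -/

instance isProbabilityMeasure_complexGaussian (v : ℝ≥0) :
    IsProbabilityMeasure (complexGaussian v) :=
  Measure.isProbabilityMeasure_map (by fun_prop)

instance isProbabilityMeasure_uniformAngle : IsProbabilityMeasure uniformAngle := by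
  unfold uniformAngle
  have := Real.pi_pos
  refine cond_isProbabilityMeasure_of_finite ?_ ?_ <;> simp [Real.volume_Ico]
  exact this

lemma isProbabilityMeasure_coin {p : ℝ} (h0 : 0 ≤ p) (h1 : p ≤ 1) :
    IsProbabilityMeasure (coin p) := by
  constructor
  simp only [coin, Measure.coe_add, Measure.coe_smul, Pi.add_apply, Pi.smul_apply, measure_univ,
    smul_eq_mul, mul_one]
  rw [← ENNReal.ofReal_add h0 (by linarith)]
  simp

lemma nakagami_density_integrable {m : ℝ} (hm : 0 < m) {e : ℝ} (he : -1 < e) (C : ℝ) :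
    IntegrableOn (fun x : ℝ => C * (x ^ e * Real.exp (-m * x ^ 2))) (Set.Ioi 0) :=
  (integrableOn_rpow_mul_exp_neg_mul_sq hm he).const_mul C

lemma measurable_nakagami_density (m w : ℝ) : Measurable fun x : ℝ => ENNReal.ofReal (if 0 < x then
      2 * m ^ m / (Real.Gamma m * w ^ m) * x ^ (2 * m - 1) * Real.exp (-m * x ^ 2 / w) else 0) := by
  refine ENNReal.measurable_ofReal.comp (Measurable.ite measurableSet_Ioi ?_ measurable_const)
  fun_prop

lemma isProbabilityMeasure_nakagami {m : ℝ} (hm : 0 < m) :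
    IsProbabilityMeasure (nakagamiMeasure m 1) := by
  constructor
  unfold nakagamiMeasure
  have hG := Real.Gamma_pos_of_pos hm
  rw [withDensity_apply _ MeasurableSet.univ, setLIntegral_univ]
  have h1 : ∀ x : ℝ, ENNReal.ofReal (if 0 < x then
      2 * m ^ m / (Real.Gamma m * 1 ^ m) * x ^ (2 * m - 1) * Real.exp (-m * x ^ 2 / 1) else 0) =
      (Set.Ioi 0).indicator (fun x : ℝ => ENNReal.ofReal
        (2 * m ^ m / Real.Gamma m * (x ^ (2 * m - 1) * Real.exp (-m * x ^ 2)))) x := by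
    intro x
    by_cases hx : 0 < x
    · simp [hx, mul_assoc]
    · simp [hx]
  simp_rw [h1]
  rw [lintegral_indicator measurableSet_Ioi, ← ofReal_integral_eq_lintegral_ofReal
    (nakagami_density_integrable hm (by linarith) _)]
  · have h2 := integral_rpow_mul_exp_neg_mul_rpow (p := 2) (q := 2 * m - 1) (b := m) two_pos
      (by linarith) hm
    simp only [Real.rpow_two] at h2
    rw [integral_const_mul, h2]
    have e1 : -(2 * m - 1 + 1) / 2 = -m := by ring
    have e2 : (2 * m - 1 + 1) / 2 = m := by ring
    rw [e1, e2, Real.rpow_neg hm.le]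
    have := (Real.rpow_pos_of_pos hm m).ne'
    rw [show 2 * m ^ m / Real.Gamma m * ((m ^ m)⁻¹ * (1 / 2) * Real.Gamma m) = 1 by field_simp]
    simp
  · filter_upwards [ae_restrict_mem measurableSet_Ioi] with x hx
    have : (0 : ℝ) < x := hx
    positivity

lemma lintegral_sq_nakagami_lt_top {m : ℝ} (hm : 0 < m) :
    ∫⁻ x, ENNReal.ofReal (x ^ 2) ∂(nakagamiMeasure m 1) < ⊤ := by
  unfold nakagamiMeasure
  have hG := Real.Gamma_pos_of_pos hm
  rw [lintegral_withDensity_eq_lintegral_mul _ (measurable_nakagami_density m 1) (by fun_prop)]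
  have h1 : ∀ x : ℝ, ((fun x : ℝ => ENNReal.ofReal (if 0 < x then
      2 * m ^ m / (Real.Gamma m * 1 ^ m) * x ^ (2 * m - 1) * Real.exp (-m * x ^ 2 / 1) else 0)) *
        fun x : ℝ => ENNReal.ofReal (x ^ 2)) x =
      (Set.Ioi 0).indicator (fun x : ℝ => ENNReal.ofReal
        (2 * m ^ m / Real.Gamma m * (x ^ (2 * m + 1) * Real.exp (-m * x ^ 2)))) x := by
    intro x
    by_cases hx : 0 < x
    · simp only [Pi.mul_apply, hx, if_true, Set.mem_Ioi, Set.indicator_of_mem]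
      rw [← ENNReal.ofReal_mul (by positivity)]
      congr 1
      rw [show 2 * m + 1 = (2 * m - 1) + (2 : ℕ) by push_cast; ring, Real.rpow_add hx,
        Real.rpow_natCast]
      simp only [Real.one_rpow, mul_one, div_one]
      ring
    · simp [hx]
  simp_rw [h1]
  rw [lintegral_indicator measurableSet_Ioi]
  exact (nakagami_density_integrable hm (by linarith) _).lintegral_lt_top

lemma lintegral_sq_gaussianReal_lt_top (v : ℝ≥0) :
    ∫⁻ x, ENNReal.ofReal (x ^ 2) ∂(gaussianReal 0 v) < ⊤ :=
  (memLp_id_gaussianReal (μ := 0) (v := v) 2).integrable_sq.lintegral_lt_top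

lemma lintegral_norm_sq_complexGaussian_lt_top (v : ℝ≥0) :
    ∫⁻ z, ENNReal.ofReal (‖z‖ ^ 2) ∂(complexGaussian v) < ⊤ := by
  unfold complexGaussian
  rw [lintegral_map (by fun_prop) (by fun_prop)]
  have h1 : ∀ q : ℝ × ℝ, ENNReal.ofReal (‖(q.1 : ℂ) + (q.2 : ℂ) * Complex.I‖ ^ 2) =
      ENNReal.ofReal (q.1 ^ 2) + ENNReal.ofReal (q.2 ^ 2) := by
    intro q
    rw [← ENNReal.ofReal_add (sq_nonneg _) (sq_nonneg _), Complex.sq_norm, Complex.normSq_add_mul_I]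
  simp_rw [h1]
  rw [lintegral_add_left (by fun_prop)]
  have hs := lintegral_sq_gaussianReal_lt_top (v / 2)
  refine ENNReal.add_lt_top.2 ⟨?_, ?_⟩
  · rwa [measurePreserving_fst.lintegral_comp (f := fun x : ℝ => ENNReal.ofReal (x ^ 2))
      (by fun_prop)]
  · rwa [measurePreserving_snd.lintegral_comp (f := fun x : ℝ => ENNReal.ofReal (x ^ 2))
      (by fun_prop)]

/-- Triangle inequality and Cauchy–Schwarz bound `|Z|²` by `N ∑ |hₙ|² |rₙ|²`, whose expectation
factorizes. This is all that finiteness of `I` needs about the actual fading. -/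
lemma lintegral_norm_sq_reflectedLaw_lt_top (N : ℕ) {mh mr : ℝ} (hmh : 0 < mh) (hmr : 0 < mr) :
    ∫⁻ z, ENNReal.ofReal (‖z‖ ^ 2) ∂(reflectedLaw N mh mr) < ⊤ := by
  have := isProbabilityMeasure_nakagami hmh
  have := isProbabilityMeasure_nakagami hmr
  unfold reflectedLaw
  rw [lintegral_map (by fun_prop) (by fun_prop)]
  have h1 : ∀ q : Fin N → ℝ × ℝ × ℝ, ENNReal.ofReal (‖∑ n, (((q n).1 * (q n).2.1 : ℝ) : ℂ) *
      Complex.exp (((q n).2.2 : ℂ) * Complex.I)‖ ^ 2) ≤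
      ∑ n, (N : ℝ≥0∞) * (ENNReal.ofReal ((q n).1 ^ 2) * ENNReal.ofReal ((q n).2.1 ^ 2)) := by
    intro q
    rw [← Finset.mul_sum]
    have h2 : ∀ n, ENNReal.ofReal ((q n).1 ^ 2) * ENNReal.ofReal ((q n).2.1 ^ 2) =
        ENNReal.ofReal (|(q n).1 * (q n).2.1| ^ 2) := by
      intro n
      rw [← ENNReal.ofReal_mul (sq_nonneg _), sq_abs, mul_pow]
    simp_rw [h2]
    rw [← ENNReal.ofReal_sum_of_nonneg (fun _ _ => by positivity), ← ENNReal.ofReal_natCast,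
      ← ENNReal.ofReal_mul (by positivity)]
    refine ENNReal.ofReal_le_ofReal ?_
    have h3 : ‖∑ n, (((q n).1 * (q n).2.1 : ℝ) : ℂ) *
        Complex.exp (((q n).2.2 : ℂ) * Complex.I)‖ ≤ ∑ n, |(q n).1 * (q n).2.1| := by
      refine (norm_sum_le _ _).trans (Finset.sum_le_sum fun n _ => ?_)
      rw [norm_mul, Complex.norm_exp_ofReal_mul_I, mul_one, Complex.norm_real, Real.norm_eq_abs]
    refine (pow_le_pow_left₀ (norm_nonneg _) h3 2).trans ?_
    simpa using sq_sum_le_card_mul_sum_sq (s := Finset.univ)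
      (f := fun n => |(q n).1 * (q n).2.1|)
  refine (lintegral_mono h1).trans_lt ?_
  rw [lintegral_finsetSum _ (fun n _ => by fun_prop)]
  refine ENNReal.sum_lt_top.2 fun n _ => ?_
  rw [lintegral_const_mul _ (by fun_prop)]
  refine ENNReal.mul_lt_top (by simp) ?_
  rw [(measurePreserving_eval (fun _ : Fin N =>
    (nakagamiMeasure mh 1).prod ((nakagamiMeasure mr 1).prod uniformAngle)) n).lintegral_comp
    (f := fun q : ℝ × ℝ × ℝ => ENNReal.ofReal (q.1 ^ 2) * ENNReal.ofReal (q.2.1 ^ 2))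
    (by fun_prop)]
  rw [lintegral_prod_mul (f := fun x : ℝ => ENNReal.ofReal (x ^ 2))
    (g := fun y : ℝ × ℝ => ENNReal.ofReal (y.1 ^ 2)) (by fun_prop) (by fun_prop)]
  refine ENNReal.mul_lt_top (lintegral_sq_nakagami_lt_top hmh) ?_
  rw [measurePreserving_fst.lintegral_comp (f := fun x : ℝ => ENNReal.ofReal (x ^ 2))
      (by fun_prop)]
  exact lintegral_sq_nakagami_lt_top hmr

/-! ### Laplace transform of the interference -/

/-- The law of the mark of a transmitter. -/
noncomputable def markLaw (p : ℝ) (ν : Measure ℂ) : Measure (Bool × ℝ × ℂ × ℂ) :=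
  (coin p).prod (uniformAngle.prod ((complexGaussian 1).prod ν))

/-- The interference power received from a transmitter at `x` with mark `y`, when `D x ψ` is the
distance from the user to a surface seen from `x` in direction `ψ`. -/
noncomputable def power (par : Params) (D : Plane → ℝ → ℝ) (x : Plane) (y : Bool × ℝ × ℂ × ℂ) :
    ℝ≥0∞ :=
  ENNReal.ofReal
    (if y.1 then
      ‖(Real.sqrt (par.etaG ‖x‖) : ℂ) * y.2.2.1
        + (Real.sqrt (par.etaH (D x y.2.1)) : ℂ) * y.2.2.2‖ ^ 2
    else ‖(Real.sqrt (par.etaG ‖x‖) : ℂ) * y.2.2.1‖ ^ 2)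

lemma measurable_power (par : Params) {D : Plane → ℝ → ℝ} (hD : Measurable (Function.uncurry D)) :
    Measurable (Function.uncurry (power par D)) := by
  refine ENNReal.measurable_ofReal.comp (Measurable.ite ?_ ?_ ?_)
  · exact (measurable_fst.comp measurable_snd) (measurableSet_singleton true)
  · have hD' : Measurable fun q : Plane × Bool × ℝ × ℂ × ℂ => D q.1 q.2.2.1 :=
      hD.comp (f := fun q : Plane × Bool × ℝ × ℂ × ℂ => (q.1, q.2.2.1)) (by fun_prop)
    unfold Params.etaG Params.etaH
    fun_prop
  · unfold Params.etaG
    fun_prop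

lemma etaG_nonneg (par : Params) {d : ℝ} (hd : 0 ≤ d) : 0 ≤ par.etaG d :=
  mul_nonneg par.Cd_pos.le (Real.rpow_nonneg hd _)

lemma etaH_nonneg (par : Params) {d : ℝ} (hd : 0 ≤ d) : 0 ≤ par.etaH d :=
  mul_nonneg par.Cr_pos.le (Real.rpow_nonneg (mul_nonneg par.d0_pos.le hd) _)

/-- Far from the user, the received power is at most `‖x‖ ^ (-α)` times a function of the mark. -/
lemma power_le (par : Params) {D : Plane → ℝ → ℝ} (hD : ∀ x ψ, ‖x‖ - par.d0 ≤ D x ψ)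
    {x : Plane} (hx : 2 * par.d0 ≤ ‖x‖) (y : Bool × ℝ × ℂ × ℂ) :
    power par D x y ≤ ENNReal.ofReal (‖x‖ ^ (-par.α)) *
      (ENNReal.ofReal (2 * par.Cd) * ENNReal.ofReal (‖y.2.2.1‖ ^ 2) +
        ENNReal.ofReal (2 * (par.Cr * (par.d0 / 2) ^ (-par.α))) *
          ENNReal.ofReal (‖y.2.2.2‖ ^ 2)) := by
  have hd0 := par.d0_pos
  have hCd := par.Cd_pos
  have hCr := par.Cr_pos
  have hx0 : 0 < ‖x‖ := by linarith
  have hGn := etaG_nonneg par hx0.le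
  -- This is where `2 * par.d0 ≤ ‖x‖` enters, and the source of the factor `par.d0 / 2`.
  have hDx : ‖x‖ / 2 ≤ D x y.2.1 := by linarith [hD x y.2.1]
  have hHn := etaH_nonneg par (show 0 ≤ D x y.2.1 by linarith)
  have hH : par.etaH (D x y.2.1) ≤ ‖x‖ ^ (-par.α) * (par.Cr * (par.d0 / 2) ^ (-par.α)) := by
    unfold Params.etaH
    have h1 : (par.d0 * D x y.2.1) ^ (-par.α) ≤ (par.d0 / 2 * ‖x‖) ^ (-par.α) := by
      refine Real.rpow_le_rpow_of_nonpos (by positivity) ?_ (by linarith [par.two_lt_α])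
      nlinarith
    rw [Real.mul_rpow (by positivity) hx0.le] at h1
    calc _ ≤ par.Cr * ((par.d0 / 2) ^ (-par.α) * ‖x‖ ^ (-par.α)) := by gcongr
      _ = _ := by ring
  have hpow : 0 ≤ ‖x‖ ^ (-par.α) := Real.rpow_nonneg hx0.le _
  have hcr : 0 ≤ par.Cr * (par.d0 / 2) ^ (-par.α) := by positivity
  rw [← ENNReal.ofReal_mul (by positivity), ← ENNReal.ofReal_mul (by positivity),
    ← ENNReal.ofReal_add (by positivity) (by positivity), ← ENNReal.ofReal_mul hpow]
  refine ENNReal.ofReal_le_ofReal ?_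
  have hg : ‖(Real.sqrt (par.etaG ‖x‖) : ℂ) * y.2.2.1‖ ^ 2 = par.etaG ‖x‖ * ‖y.2.2.1‖ ^ 2 := by
    rw [norm_mul, mul_pow, Complex.norm_real, Real.norm_eq_abs, sq_abs, Real.sq_sqrt hGn]
  have hz : ‖(Real.sqrt (par.etaH (D x y.2.1)) : ℂ) * y.2.2.2‖ ^ 2 =
      par.etaH (D x y.2.1) * ‖y.2.2.2‖ ^ 2 := by
    rw [norm_mul, mul_pow, Complex.norm_real, Real.norm_eq_abs, sq_abs, Real.sq_sqrt hHn]
  have hG : par.etaG ‖x‖ = ‖x‖ ^ (-par.α) * par.Cd := mul_comm _ _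
  have hHz := mul_le_mul_of_nonneg_right hH (sq_nonneg ‖y.2.2.2‖)
  have hGg : 0 ≤ ‖x‖ ^ (-par.α) * par.Cd * ‖y.2.2.1‖ ^ 2 := by positivity
  have hzz : 0 ≤ ‖x‖ ^ (-par.α) * (par.Cr * (par.d0 / 2) ^ (-par.α)) * ‖y.2.2.2‖ ^ 2 := by
    positivity
  split_ifs
  · have h2 : ∀ a b : ℂ, ‖a + b‖ ^ 2 ≤ 2 * ‖a‖ ^ 2 + 2 * ‖b‖ ^ 2 := fun a b => by
      have := norm_add_le a b
      nlinarith [norm_nonneg (a + b), sq_nonneg (‖a‖ - ‖b‖)]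
    refine (h2 _ _).trans ?_
    rw [hg, hz, hG]
    nlinarith
  · rw [hg, hG]
    nlinarith

lemma lintegral_markLaw_bound_lt_top {p : ℝ} {ν : Measure ℂ} [IsProbabilityMeasure ν]
    [IsProbabilityMeasure (coin p)] (hν : ∫⁻ z, ENNReal.ofReal (‖z‖ ^ 2) ∂ν < ⊤) (a b : ℝ) :
    ∫⁻ y, (ENNReal.ofReal a * ENNReal.ofReal (‖y.2.2.1‖ ^ 2) +
      ENNReal.ofReal b * ENNReal.ofReal (‖y.2.2.2‖ ^ 2)) ∂(markLaw p ν) < ⊤ := by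
  unfold markLaw
  rw [lintegral_add_left (by fun_prop), lintegral_const_mul _ (by fun_prop),
    lintegral_const_mul _ (by fun_prop)]
  have hp : MeasurePreserving (fun y : Bool × ℝ × ℂ × ℂ => y.2.2)
      ((coin p).prod (uniformAngle.prod ((complexGaussian 1).prod ν)))
      ((complexGaussian 1).prod ν) :=
    measurePreserving_snd.comp measurePreserving_snd
  refine ENNReal.add_lt_top.2 ⟨ENNReal.mul_lt_top ENNReal.ofReal_lt_top ?_,
    ENNReal.mul_lt_top ENNReal.ofReal_lt_top ?_⟩
  · refine ((measurePreserving_fst.comp hp).lintegral_comp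
      (f := fun z : ℂ => ENNReal.ofReal (‖z‖ ^ 2)) (by fun_prop)).trans_lt ?_
    exact lintegral_norm_sq_complexGaussian_lt_top 1
  · exact ((measurePreserving_snd.comp hp).lintegral_comp
      (f := fun z : ℂ => ENNReal.ofReal (‖z‖ ^ 2)) (by fun_prop)).trans_lt hν

/-- The exponent of the Laplace functional tends to `0` at `0`. -/
lemma tendsto_lintegral_one_sub_power (par : Params) {D : Plane → ℝ → ℝ}
    (hDm : Measurable (Function.uncurry D)) (hD : ∀ x ψ, ‖x‖ - par.d0 ≤ D x ψ)
    {ν : Measure ℂ} [IsProbabilityMeasure ν] (hν : ∫⁻ z, ENNReal.ofReal (‖z‖ ^ 2) ∂ν < ⊤)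
    {s : ℕ → ℝ≥0∞} (hs1 : ∀ n, s n ≤ 1) (hs : Filter.Tendsto s Filter.atTop (nhds 0)) :
    Filter.Tendsto (fun n => ∫⁻ x, (1 - ∫⁻ y, expNeg (s n * power par D x y) ∂(markLaw par.p ν)))
      Filter.atTop (nhds 0) := by
  have := isProbabilityMeasure_coin par.p_nonneg par.p_le_one
  have : IsProbabilityMeasure (markLaw par.p ν) := by unfold markLaw; infer_instance
  have hα := par.two_lt_α
  have hd0 := par.d0_pos
  have hpm := measurable_power par hDm
  have hpmx : ∀ x, Measurable (power par D x) := fun x => hpm.comp measurable_prodMk_left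
  have hem : ∀ n, Measurable (Function.uncurry fun x y => expNeg (s n * power par D x y)) :=
    fun n => measurable_expNeg.comp (measurable_const.mul hpm)
  set K := ∫⁻ y, (ENNReal.ofReal (2 * par.Cd) * ENNReal.ofReal (‖y.2.2.1‖ ^ 2) +
        ENNReal.ofReal (2 * (par.Cr * (par.d0 / 2) ^ (-par.α))) *
          ENNReal.ofReal (‖y.2.2.2‖ ^ 2)) ∂(markLaw par.p ν) with hK
  have hKtop : K < ⊤ := lintegral_markLaw_bound_lt_top hν _ _
  -- The first summand serves the points near the user, the second those far away.
  set C : ℝ≥0∞ := ENNReal.ofReal ((2 * par.d0 + 2) ^ par.α) + ENNReal.ofReal (2 ^ par.α) * K with hC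
  have hCtop : C ≠ ⊤ := (ENNReal.add_lt_top.2 ⟨ENNReal.ofReal_lt_top,
    ENNReal.mul_lt_top ENNReal.ofReal_lt_top hKtop⟩).ne
  have hbound : ∀ n x, 1 - ∫⁻ y, expNeg (s n * power par D x y) ∂(markLaw par.p ν) ≤
      C * ENNReal.ofReal ((1 + ‖x‖) ^ (-par.α)) := by
    intro n x
    have hx1 : 0 < 1 + ‖x‖ := by positivity
    -- The part `2 * par.d0` is for `power_le`; the extra `1` gives `‖x‖ ≥ (1 + ‖x‖) / 2`.
    by_cases hx : 2 * par.d0 + 1 ≤ ‖x‖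
    · have hx0 : 0 < ‖x‖ := by linarith
      have h1 : 1 - ∫⁻ y, expNeg (s n * power par D x y) ∂(markLaw par.p ν) ≤
          ∫⁻ y, power par D x y ∂(markLaw par.p ν) := by
        rw [tsub_le_iff_right, ← lintegral_add_left (hpmx x)]
        calc (1 : ℝ≥0∞) = ∫⁻ _, 1 ∂(markLaw par.p ν) := by simp
          _ ≤ _ := lintegral_mono fun y => ?_
        refine (one_le_add_expNeg (s n * power par D x y)).trans (add_le_add_left ?_ _)
        exact mul_le_of_le_one_left' (hs1 n)
      have h2 : ∫⁻ y, power par D x y ∂(markLaw par.p ν) ≤ ENNReal.ofReal (‖x‖ ^ (-par.α)) * K := by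
        rw [hK, ← lintegral_const_mul _ (by fun_prop)]
        exact lintegral_mono fun y => power_le par hD (by linarith) y
      refine h1.trans (h2.trans ?_)
      have h3 : ‖x‖ ^ (-par.α) ≤ 2 ^ par.α * (1 + ‖x‖) ^ (-par.α) := by
        have : ‖x‖ ^ (-par.α) ≤ ((1 / 2) * (1 + ‖x‖)) ^ (-par.α) :=
          Real.rpow_le_rpow_of_nonpos (by positivity) (by linarith) (by linarith)
        rw [Real.mul_rpow (by norm_num) hx1.le] at this
        refine this.trans (le_of_eq ?_)
        rw [one_div, Real.inv_rpow two_pos.le, Real.rpow_neg two_pos.le, inv_inv]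
      calc _ ≤ ENNReal.ofReal (2 ^ par.α * (1 + ‖x‖) ^ (-par.α)) * K := by gcongr
        _ = ENNReal.ofReal (2 ^ par.α) * K * ENNReal.ofReal ((1 + ‖x‖) ^ (-par.α)) := by
          rw [ENNReal.ofReal_mul (by positivity)]; ring
        _ ≤ _ := by gcongr; exact le_add_self
    · have h3 : 1 ≤ (2 * par.d0 + 2) ^ par.α * (1 + ‖x‖) ^ (-par.α) := by
        have : (2 * par.d0 + 2) ^ (-par.α) ≤ (1 + ‖x‖) ^ (-par.α) :=
          Real.rpow_le_rpow_of_nonpos hx1 (by linarith) (by linarith)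
        calc (1 : ℝ) = (2 * par.d0 + 2) ^ par.α * (2 * par.d0 + 2) ^ (-par.α) := by
              rw [← Real.rpow_add (by positivity)]; simp
          _ ≤ _ := by gcongr
      calc _ ≤ (1 : ℝ≥0∞) := tsub_le_self
        _ ≤ ENNReal.ofReal ((2 * par.d0 + 2) ^ par.α * (1 + ‖x‖) ^ (-par.α)) := by
          simpa using ENNReal.ofReal_le_ofReal h3
        _ = ENNReal.ofReal ((2 * par.d0 + 2) ^ par.α) * ENNReal.ofReal ((1 + ‖x‖) ^ (-par.α)) :=
          ENNReal.ofReal_mul (by positivity)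
        _ ≤ _ := by gcongr; exact le_self_add
  have hlim : ∀ x, Filter.Tendsto
      (fun n => 1 - ∫⁻ y, expNeg (s n * power par D x y) ∂(markLaw par.p ν))
      Filter.atTop (nhds 0) := by
    intro x
    have h1 := tendsto_lintegral_expNeg (markLaw par.p ν)
      (F := fun n y => s n * power par D x y) (G := fun _ => 0)
      (fun n => measurable_const.mul (hpmx x)) (fun y => by
        simpa using ENNReal.Tendsto.mul_const (b := power par D x y) hs
          (Or.inr ENNReal.ofReal_ne_top))
    have h2 := ENNReal.Tendsto.sub (tendsto_const_nhds (x := (1 : ℝ≥0∞))) h1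
      (Or.inl ENNReal.one_ne_top)
    simpa using h2
  have := tendsto_lintegral_of_dominated_convergence (μ := (volume : Measure Plane)) _
    (fun n => measurable_const.sub (hem n).lintegral_prod_right') (fun n => .of_forall (hbound n))
    ?_ (.of_forall hlim)
  · simpa using this
  -- The dominating function is integrable because `α` exceeds the dimension `2`.
  · rw [lintegral_const_mul _ (by fun_prop)]
    refine (ENNReal.mul_lt_top hCtop.lt_top (finite_integral_one_add_norm ?_)).ne
    simpa using hα

namespace Network

variable {par : Params} {lam : ℝ} {ν : Measure ℂ} {Ω : Type*} [MeasurableSpace Ω] {μ : Measure Ω}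
variable (W : Network par lam ν μ)

/-- The mark of the `k`-th transmitter. -/
def mark (k : ℕ) (ω : Ω) : Bool × ℝ × ℂ × ℂ := (W.b k ω, W.ψ k ω, W.g k ω, W.Z k ω)

lemma measurable_mark (k : ℕ) : Measurable (W.mark k) :=
  (W.measurable_b k).prodMk ((W.measurable_ψ k).prodMk
    ((W.measurable_g k).prodMk (W.measurable_Z k)))

lemma interference_eq_tsum_power {D : Plane → ℝ → ℝ} {dR : ℕ → Ω → ℝ}
    (hdR : ∀ k ω, dR k ω = D (W.X k ω) (W.ψ k ω)) (ω : Ω) :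
    W.interference dR ω = ∑' k, power par D (W.X k ω) (W.mark k ω) := by
  unfold interference
  simp_rw [hdR]
  rfl

lemma measurable_interference {D : Plane → ℝ → ℝ} (hDm : Measurable (Function.uncurry D))
    {dR : ℕ → Ω → ℝ} (hdR : ∀ k ω, dR k ω = D (W.X k ω) (W.ψ k ω)) :
    Measurable (W.interference dR) := by
  rw [funext (W.interference_eq_tsum_power hdR)]
  exact Measurable.tsum fun k => (measurable_power par hDm).comp
    ((W.X_hppp.measurable k).prodMk (W.measurable_mark k))

variable [IsProbabilityMeasure μ]

/-- Finiteness matters: where `I = ∞`, `toReal` is `0`, so the real integrand is `1` instead of `0`.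
-/
lemma laplace_eq_lintegral {dR : ℕ → Ω → ℝ} (hI : Measurable (W.interference dR))
    (hfin : ∀ᵐ ω ∂μ, W.interference dR ω < ⊤) {s : ℝ} (hs : 0 ≤ s) :
    ENNReal.ofReal (W.laplace dR s) =
      ∫⁻ ω, expNeg (ENNReal.ofReal s * W.interference dR ω) ∂μ := by
  unfold laplace
  rw [ofReal_integral_eq_lintegral_ofReal]
  · refine lintegral_congr_ae ?_
    filter_upwards [hfin] with ω hω
    rw [expNeg_of_ne_top (ENNReal.mul_ne_top ENNReal.ofReal_ne_top hω.ne), ENNReal.toReal_mul,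
      ENNReal.toReal_ofReal hs, neg_mul]
  · refine Integrable.of_bound (C := 1)
      (Real.measurable_exp.comp (hI.ennreal_toReal.const_mul (-s))).aestronglyMeasurable (.of_forall fun ω => ?_)
    rw [Real.norm_eq_abs, Real.abs_exp, Real.exp_le_one_iff]
    nlinarith [mul_nonneg hs (ENNReal.toReal_nonneg (a := W.interference dR ω))]
  · exact .of_forall fun ω => (Real.exp_pos _).le

variable [IsProbabilityMeasure ν]

lemma lintegral_expNeg_interference (hlam : 0 ≤ lam) {D : Plane → ℝ → ℝ}
    (hDm : Measurable (Function.uncurry D))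
    {dR : ℕ → Ω → ℝ} (hdR : ∀ k ω, dR k ω = D (W.X k ω) (W.ψ k ω)) (s : ℝ≥0∞) :
    ∫⁻ ω, expNeg (s * W.interference dR ω) ∂μ =
      expNeg (ENNReal.ofReal lam *
        ∫⁻ x, (1 - ∫⁻ y, expNeg (s * power par D x y) ∂(markLaw par.p ν))) := by
  have := isProbabilityMeasure_coin par.p_nonneg par.p_le_one
  have : IsProbabilityMeasure (markLaw par.p ν) := by unfold markLaw; infer_instance
  have hXM : IndepFun (fun ω k => W.X k ω) (fun ω k => W.mark k ω) μ :=
    W.indep_X.comp measurable_id measurable_snd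
  simp_rw [W.interference_eq_tsum_power hdR, ← ENNReal.tsum_mul_left]
  exact W.X_hppp.lintegral_expNeg_tsum_marked hlam W.measurable_mark W.mark_law W.mark_indep hXM
    (f := fun x y => s * power par D x y) (measurable_const.mul (measurable_power par hDm))

/-- For `s > 0`, `e^{-sI}` is at most the indicator of `I < ∞`. Along `s = 1/(n+1)` its expectation
tends to `1`, as the exponent of the Laplace functional tends to `0`. -/
lemma ae_interference_lt_top (hlam : 0 ≤ lam) {D : Plane → ℝ → ℝ}
    (hDm : Measurable (Function.uncurry D)) (hD : ∀ x ψ, ‖x‖ - par.d0 ≤ D x ψ)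
    (hν : ∫⁻ z, ENNReal.ofReal (‖z‖ ^ 2) ∂ν < ⊤)
    {dR : ℕ → Ω → ℝ} (hdR : ∀ k ω, dR k ω = D (W.X k ω) (W.ψ k ω)) :
    ∀ᵐ ω ∂μ, W.interference dR ω < ⊤ := by
  set s : ℕ → ℝ≥0∞ := fun n => ((n : ℝ≥0∞) + 1)⁻¹ with hsdef
  have hs0 : ∀ n, s n ≠ 0 := fun n => ENNReal.inv_ne_zero.2 (by simp)
  have hs1 : ∀ n, s n ≤ 1 := fun n => ENNReal.inv_le_one.2 le_add_self
  have hs : Filter.Tendsto s Filter.atTop (nhds 0) := by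
    have := (Filter.tendsto_add_atTop_iff_nat 1).2 ENNReal.tendsto_inv_nat_nhds_zero
    simpa [hsdef] using this
  have hI := W.measurable_interference hDm hdR
  have hset : MeasurableSet {ω | W.interference dR ω < ⊤} := hI measurableSet_Iio
  have hle : ∀ n, ∫⁻ ω, expNeg (s n * W.interference dR ω) ∂μ ≤
      μ {ω | W.interference dR ω < ⊤} := by
    intro n
    rw [← lintegral_indicator_one hset]
    refine lintegral_mono fun ω => ?_
    by_cases hω : W.interference dR ω < ⊤
    · simpa [Set.indicator, hω] using expNeg_le_one _
    · have : W.interference dR ω = ⊤ := by simpa using hω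
      simp [this, ENNReal.mul_top (hs0 n)]
  have hlim : Filter.Tendsto (fun n => ∫⁻ ω, expNeg (s n * W.interference dR ω) ∂μ)
      Filter.atTop (nhds 1) := by
    simp_rw [W.lintegral_expNeg_interference hlam hDm hdR]
    have h1 := ENNReal.Tendsto.const_mul (a := ENNReal.ofReal lam)
      (tendsto_lintegral_one_sub_power par hDm hD hν hs1 hs) (Or.inr ENNReal.ofReal_ne_top)
    have h2 := (continuous_expNeg.tendsto _).comp h1
    rw [mul_zero, expNeg_zero] at h2
    exact h2
  have h1 : 1 ≤ μ {ω | W.interference dR ω < ⊤} := le_of_tendsto' hlim hle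
  rw [ae_iff_measure_eq hset.nullMeasurableSet]
  simpa using le_antisymm prob_le_one h1

end Network

/-! ### Factorization of the coverage probability -/

/-- With scale `√2 / 2` the density is `2x e^{-x²}`, with antiderivative `-e^{-x²}`: the squared
variable is exponential with mean one. -/
lemma rayleighMeasure_tail {a η : ℝ} (ha : 0 ≤ a) (hη : 0 < η) :
    rayleighMeasure (Real.sqrt 2 / 2) {r | a < η * r ^ 2} = ENNReal.ofReal (Real.exp (-(a / η))) := by
  have hσ : (Real.sqrt 2 / 2) ^ 2 = 1 / 2 := by
    rw [div_pow, Real.sq_sqrt two_pos.le]; norm_num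
  set b := Real.sqrt (a / η) with hb
  have hb0 : 0 ≤ b := Real.sqrt_nonneg _
  have hbsq : b ^ 2 = a / η := Real.sq_sqrt (by positivity)
  have hset : MeasurableSet {r : ℝ | a < η * r ^ 2} := measurableSet_lt (by fun_prop) (by fun_prop)
  unfold rayleighMeasure
  rw [withDensity_apply _ hset, ← lintegral_indicator hset, hσ]
  have h1 : ∀ x : ℝ, {r : ℝ | a < η * r ^ 2}.indicator (fun x => ENNReal.ofReal
      (if 0 < x then x / (1 / 2) * Real.exp (-x ^ 2 / (2 * (1 / 2))) else 0)) x =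
      (Set.Ioi b).indicator (fun x => ENNReal.ofReal (2 * x * Real.exp (-x ^ 2))) x := by
    intro x
    have hiff : a < η * x ^ 2 ↔ b ^ 2 < x ^ 2 := by
      rw [hbsq, div_lt_iff₀ hη, mul_comm]
    by_cases hx : b < x
    · have hx0 : 0 < x := hb0.trans_lt hx
      have : a < η * x ^ 2 := hiff.2 (pow_lt_pow_left₀ hx hb0 two_ne_zero)
      simp only [Set.indicator, Set.mem_ofPred_eq, this, Set.mem_Ioi, hx, hx0, if_true]
      congr 1
      ring_nf
    · rw [Set.indicator_of_notMem (s := Set.Ioi b) (by simpa using hx)]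
      by_cases hx0 : 0 < x
      · have : ¬ a < η * x ^ 2 := fun h =>
          hx (lt_of_pow_lt_pow_left₀ 2 hx0.le (hiff.1 h))
        simp [Set.indicator, this]
      · simp [Set.indicator, hx0]
  simp_rw [h1]
  rw [lintegral_indicator measurableSet_Ioi]
  have hderiv : ∀ x ∈ Set.Ici b, HasDerivAt (fun x : ℝ => -Real.exp (-x ^ 2))
      (2 * x * Real.exp (-x ^ 2)) x := by
    intro x _
    have h : HasDerivAt (fun x : ℝ => -Real.exp (-x ^ 2)) _ x := ((hasDerivAt_pow 2 x).fun_neg.exp).fun_neg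
    refine h.congr_deriv ?_
    push_cast; ring
  have hnn : ∀ x ∈ Set.Ioi b, 0 ≤ 2 * x * Real.exp (-x ^ 2) := fun x hx => by
    have : 0 < x := hb0.trans_lt hx
    positivity
  have hlim : Filter.Tendsto (fun x : ℝ => -Real.exp (-x ^ 2)) Filter.atTop (nhds 0) := by
    have : Filter.Tendsto (fun x : ℝ => x ^ 2) Filter.atTop Filter.atTop :=
      Filter.tendsto_pow_atTop two_ne_zero
    simpa using (Real.tendsto_exp_neg_atTop_nhds_zero.comp this).neg
  rw [← ofReal_integral_eq_lintegral_ofReal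
    (integrableOn_Ioi_deriv_of_nonneg' hderiv hnn hlim),
    integral_Ioi_of_hasDerivAt_of_nonneg' hderiv hnn hlim, hbsq]
  · simp
  · filter_upwards [ae_restrict_mem measurableSet_Ioi] with x hx using hnn x hx

/-- The hypotheses make the joint law of the three variables a product of three laws, and a product
may be regrouped. Used to separate the serving channel from locations and marks jointly. -/
lemma indepFun_prodMk_of_indepFun {Ω A B C : Type*} [MeasurableSpace Ω] [MeasurableSpace A]
    [MeasurableSpace B] [MeasurableSpace C] {μ : Measure Ω} [IsProbabilityMeasure μ]
    {X : Ω → A} {G : Ω → B} {M : Ω → C} (hX : Measurable X) (hG : Measurable G) (hM : Measurable M)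
    (h1 : IndepFun X (fun ω => (G ω, M ω)) μ) (h2 : IndepFun G M μ) :
    IndepFun G (fun ω => (X ω, M ω)) μ := by
  have h3 : IndepFun X M μ := h1.comp measurable_id measurable_snd
  rw [indepFun_iff_map_prod_eq_prod_map_map (by fun_prop) (by fun_prop)] at h1 h2 h3 ⊢
  rw [h2] at h1
  rw [h3]
  have := Measure.isProbabilityMeasure_map (μ := μ) hX.aemeasurable
  have := Measure.isProbabilityMeasure_map (μ := μ) hG.aemeasurable
  have := Measure.isProbabilityMeasure_map (μ := μ) hM.aemeasurable
  have hp := (measurePreserving_prodAssoc (μ.map G) (μ.map X) (μ.map M)).comp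
    (((Measure.measurePreserving_swap (μ := μ.map X) (ν := μ.map G)).prod
      (MeasurePreserving.id (μ.map M))).comp
      (measurePreserving_prodAssoc (μ.map X) (μ.map G) (μ.map M)).symm)
  rw [← hp.map_eq, ← h1, Measure.map_map hp.measurable (by fun_prop)]
  rfl

namespace Network

variable {par : Params} {lam : ℝ} {ν : Measure ℂ} {Ω : Type*} [MeasurableSpace Ω] {μ : Measure Ω}
variable (W : Network par lam ν μ) [IsProbabilityMeasure μ]

lemma indepFun_norm_g0_interference {D : Plane → ℝ → ℝ}
    (hDm : Measurable (Function.uncurry D))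
    {dR : ℕ → Ω → ℝ} (hdR : ∀ k ω, dR k ω = D (W.X k ω) (W.ψ k ω)) :
    IndepFun (fun ω => ‖W.g0 ω‖) (W.interference dR) μ := by
  have h := indepFun_prodMk_of_indepFun (measurable_pi_lambda _ W.X_hppp.measurable)
    W.measurable_g0 (measurable_pi_lambda _ W.measurable_mark) W.indep_X W.indep_g0
  rw [funext (W.interference_eq_tsum_power hdR)]
  refine h.comp (φ := fun z : ℂ => ‖z‖) (ψ := fun q : (ℕ → Plane) × (ℕ → Bool × ℝ × ℂ × ℂ) =>
    ∑' k, power par D (q.1 k) (q.2 k)) measurable_norm (Measurable.tsum fun k => ?_)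
  exact (measurable_power par hDm).comp
    (f := fun q : (ℕ → Plane) × (ℕ → Bool × ℝ × ℂ × ℂ) => (q.1 k, q.2 k))
    (((measurable_pi_apply k).comp measurable_fst).prodMk
      ((measurable_pi_apply k).comp measurable_snd))

theorem coverage_eq {D : Plane → ℝ → ℝ} (hDm : Measurable (Function.uncurry D))
    {dR : ℕ → Ω → ℝ} (hdR : ∀ k ω, dR k ω = D (W.X k ω) (W.ψ k ω))
    (hfin : ∀ᵐ ω ∂μ, W.interference dR ω < ⊤) {t : ℝ} (ht : 0 ≤ t) :
    W.coverage dR t =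
      Real.exp (-(t * par.gammaT⁻¹ / par.etaG0)) * W.laplace dR (t / par.etaG0) := by
  have hI := W.measurable_interference hDm hdR
  have hη : 0 < par.etaG0 :=
    mul_pos par.Cd_pos (Real.rpow_pos_of_pos (norm_pos_iff.2 par.x0_ne_zero) _)
  have hγ : 0 < par.gammaT⁻¹ := inv_pos.2 (div_pos par.P_pos par.noise_pos)
  have hg := W.measurable_g0.norm
  have hs : 0 ≤ t / par.etaG0 := by positivity
  set c := ENNReal.ofReal par.gammaT⁻¹ with hc
  set S : Set (ℝ × ℝ≥0∞) :=
    {q | ENNReal.ofReal t < ENNReal.ofReal (par.etaG0 * q.1 ^ 2) / (q.2 + c)} with hS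
  have hSm : MeasurableSet S := measurableSet_lt (by fun_prop) (by fun_prop)
  have hind := (indepFun_iff_map_prod_eq_prod_map_map hg.aemeasurable hI.aemeasurable).1
    (W.indepFun_norm_g0_interference hDm hdR)
  have hprob := Measure.isProbabilityMeasure_map (μ := μ) hI.aemeasurable
  have hprob' := Measure.isProbabilityMeasure_map (μ := μ) hg.aemeasurable
  -- Coverage given `I = i` is an exponential tail, hence itself a Laplace kernel in `i`.
  have hslice : ∀ i : ℝ≥0∞, i < ⊤ → (μ.map fun ω => ‖W.g0 ω‖) ((fun r => (r, i)) ⁻¹' S) =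
      expNeg (ENNReal.ofReal (t / par.etaG0) * (i + c)) := by
    intro i hi
    have hic : i + c ≠ ⊤ := ENNReal.add_ne_top.2 ⟨hi.ne, ENNReal.ofReal_ne_top⟩
    have hic0 : i + c ≠ 0 := by
      intro h
      rw [add_eq_zero] at h
      exact (ENNReal.ofReal_pos.2 hγ).ne' h.2
    have hset : (fun r : ℝ => (r, i)) ⁻¹' S = {r | t * (i + c).toReal < par.etaG0 * r ^ 2} := by
      ext r
      simp only [hS, Set.mem_preimage, Set.mem_ofPred_eq]
      rw [ENNReal.lt_div_iff_mul_lt (Or.inl hic0) (Or.inl hic)]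
      conv_lhs => rw [← ENNReal.ofReal_toReal hic]
      rw [← ENNReal.ofReal_mul ht, ENNReal.ofReal_lt_ofReal_iff_of_nonneg (by positivity)]
    rw [hset, W.g0_law, rayleighMeasure_tail (by positivity) hη,
      expNeg_of_ne_top (ENNReal.mul_ne_top ENNReal.ofReal_ne_top hic), ENNReal.toReal_mul,
      ENNReal.toReal_ofReal hs]
    congr 3; ring
  have hmain : μ {ω | ENNReal.ofReal t < W.sinr dR ω} =
      ENNReal.ofReal (Real.exp (-(t * par.gammaT⁻¹ / par.etaG0)) *
        W.laplace dR (t / par.etaG0)) := by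
    calc μ {ω | ENNReal.ofReal t < W.sinr dR ω}
        = (μ.map fun ω => (‖W.g0 ω‖, W.interference dR ω)) S := by
          rw [Measure.map_apply (hg.prodMk hI) hSm]; rfl
      _ = ∫⁻ i, (μ.map fun ω => ‖W.g0 ω‖) ((fun r => (r, i)) ⁻¹' S) ∂(μ.map (W.interference dR)) := by
          rw [hind, Measure.prod_apply_symm hSm]
      _ = ∫⁻ ω, (μ.map fun ω => ‖W.g0 ω‖) ((fun r => (r, W.interference dR ω)) ⁻¹' S) ∂μ := by
          rw [lintegral_map (measurable_measure_prodMk_right hSm) hI]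
      _ = ∫⁻ ω, expNeg (ENNReal.ofReal (t / par.etaG0) * c) *
            expNeg (ENNReal.ofReal (t / par.etaG0) * W.interference dR ω) ∂μ := by
          refine lintegral_congr_ae ?_
          filter_upwards [hfin] with ω hω
          rw [hslice _ hω, mul_add, expNeg_add, mul_comm]
      _ = _ := by
          rw [lintegral_const_mul _ (by fun_prop),
            ← W.laplace_eq_lintegral hI hfin hs, hc, ← ENNReal.ofReal_mul hs,
            expNeg_ofReal (by positivity), ← ENNReal.ofReal_mul (Real.exp_pos _).le]
          congr 4; ring
  unfold coverage
  rw [measureReal_def, hmain, ENNReal.toReal_ofReal]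
  exact mul_nonneg (Real.exp_pos _).le (integral_nonneg fun _ => (Real.exp_pos _).le)

end Network

/-! ### Closed form for complex Gaussian fading -/

/-- A Bochner integral with nonzero value forces integrability, so known integral formulas transfer
with no separate integrability proof. -/
lemma lintegral_ofReal_eq_of_integral_eq {A : Type*} [MeasurableSpace A] {μ : Measure A}
    {f : A → ℝ} {v : ℝ} (hv : v ≠ 0) (hf : 0 ≤ᵐ[μ] f) (h : ∫ x, f x ∂μ = v) :
    ∫⁻ x, ENNReal.ofReal (f x) ∂μ = ENNReal.ofReal v := by
  rw [← ofReal_integral_eq_lintegral_ofReal _ hf, h]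
  exact Integrable.of_integral_ne_zero (h ▸ hv)

lemma lintegral_exp_neg_sq_gaussianReal {s : ℝ} (hs : 0 ≤ s) (v : ℝ≥0) :
    ∫⁻ x, ENNReal.ofReal (Real.exp (-(s * x ^ 2))) ∂(gaussianReal 0 v) =
      ENNReal.ofReal (1 / Real.sqrt (1 + 2 * s * v)) := by
  by_cases hv : v = 0
  · subst hv
    simp
  have hv0 : 0 < (v : ℝ) := by positivity
  refine lintegral_ofReal_eq_of_integral_eq (by positivity)
    (.of_forall fun x => (Real.exp_pos _).le) ?_
  rw [integral_gaussianReal_eq_integral_smul hv]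
  have h1 : ∀ x : ℝ, gaussianPDFReal 0 v x • Real.exp (-(s * x ^ 2)) =
      (Real.sqrt (2 * Real.pi * v))⁻¹ * Real.exp (-(s + 1 / (2 * v)) * x ^ 2) := by
    intro x
    rw [gaussianPDFReal, smul_eq_mul, mul_assoc, ← Real.exp_add]
    congr 2
    field_simp
    ring
  simp_rw [h1]
  rw [integral_const_mul, integral_gaussian, ← Real.sqrt_inv, ← Real.sqrt_mul (by positivity),
    show 1 / √(1 + 2 * s * v) = √(1 + 2 * s * v)⁻¹ by rw [one_div, Real.sqrt_inv]]
  congr 1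
  have := Real.pi_pos
  field_simp
  ring

lemma map_linear_prod_gaussianReal (c d : ℝ) (v w : ℝ≥0) :
    ((gaussianReal 0 v).prod (gaussianReal 0 w)).map (fun q => c * q.1 + d * q.2) =
      gaussianReal 0 (NNReal.mk (c ^ 2) (sq_nonneg c) * v + NNReal.mk (d ^ 2) (sq_nonneg d) * w) := by
  have h := gaussianReal_conv_gaussianReal (m₁ := c * 0) (m₂ := d * 0)
    (v₁ := NNReal.mk (c ^ 2) (sq_nonneg c) * v) (v₂ := NNReal.mk (d ^ 2) (sq_nonneg d) * w)
  rw [← gaussianReal_map_const_mul, ← gaussianReal_map_const_mul, Measure.conv,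
    Measure.map_prod_map _ _ (by fun_prop) (by fun_prop),
    Measure.map_map (by fun_prop) (by fun_prop)] at h
  simpa [Function.comp_def] using h

lemma lintegral_complexGaussian (v : ℝ≥0) {f : ℂ → ℝ≥0∞} (hf : Measurable f) :
    ∫⁻ z, f z ∂(complexGaussian v) =
      ∫⁻ q : ℝ × ℝ, f (q.1 + q.2 * Complex.I)
        ∂((gaussianReal 0 (v / 2)).prod (gaussianReal 0 (v / 2))) :=
  lintegral_map hf (by fun_prop)

/-- The real and imaginary parts of the combination are independent Gaussians of variance `(c² v +
d² w) / 2`. Each contributes an inverse square root, and the two multiply to the transform of an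
exponential variable. -/
lemma lintegral_expNeg_norm_sq_complexGaussian {s : ℝ} (hs : 0 ≤ s) (c d : ℝ) (v w : ℝ≥0) :
    ∫⁻ q, expNeg (ENNReal.ofReal s * ENNReal.ofReal (‖(c : ℂ) * q.1 + (d : ℂ) * q.2‖ ^ 2))
        ∂((complexGaussian v).prod (complexGaussian w)) =
      ENNReal.ofReal (1 / (1 + s * (c ^ 2 * v + d ^ 2 * w))) := by
  set E : ℝ → ℝ → ℝ≥0∞ := fun x u => ENNReal.ofReal (Real.exp (-(s * (c * x + d * u) ^ 2))) with hE
  have hEm : Measurable (Function.uncurry E) := by unfold E Function.uncurry; fun_prop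
  have hEx : ∀ x, Measurable (E x) := fun x => by unfold E; fun_prop
  set J : ℝ → ℝ≥0∞ := fun x => ∫⁻ u, E x u ∂(gaussianReal 0 (w / 2)) with hJ
  have hJm : Measurable J := hEm.lintegral_prod_right'
  have hpt : ∀ x y u w : ℝ, expNeg (ENNReal.ofReal s * ENNReal.ofReal
      (‖(c : ℂ) * (x + y * Complex.I) + (d : ℂ) * (u + w * Complex.I)‖ ^ 2)) = E x u * E y w := by
    intro x y u w
    have h1 : (c : ℂ) * (x + y * Complex.I) + (d : ℂ) * (u + w * Complex.I) =
        ((c * x + d * u : ℝ) : ℂ) + ((c * y + d * w : ℝ) : ℂ) * Complex.I := by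
      push_cast; ring
    rw [h1, Complex.sq_norm, Complex.normSq_add_mul_I, ← ENNReal.ofReal_mul hs,
      expNeg_ofReal (by positivity), hE, ← ENNReal.ofReal_mul (Real.exp_pos _).le, ← Real.exp_add]
    congr 2; ring
  have hFm : Measurable fun q : ℂ × ℂ => expNeg (ENNReal.ofReal s *
      ENNReal.ofReal (‖(c : ℂ) * q.1 + (d : ℂ) * q.2‖ ^ 2)) := by fun_prop
  have hinner : ∀ x y : ℝ, ∫⁻ z, expNeg (ENNReal.ofReal s * ENNReal.ofReal
      (‖(c : ℂ) * (x + y * Complex.I) + (d : ℂ) * z‖ ^ 2)) ∂(complexGaussian w) = J x * J y := by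
    intro x y
    rw [lintegral_complexGaussian w (by fun_prop)]
    simp_rw [hpt]
    exact lintegral_prod_mul (hEx x).aemeasurable (hEx y).aemeasurable
  have hJint : ∫⁻ x, J x ∂(gaussianReal 0 (v / 2)) =
      ENNReal.ofReal (1 / Real.sqrt (1 + s * (c ^ 2 * v + d ^ 2 * w))) := by
    have h1 : ∫⁻ x, J x ∂(gaussianReal 0 (v / 2)) =
        ∫⁻ q, ENNReal.ofReal (Real.exp (-(s * (c * q.1 + d * q.2) ^ 2)))
          ∂((gaussianReal 0 (v / 2)).prod (gaussianReal 0 (w / 2))) :=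
      (lintegral_prod _ hEm.aemeasurable).symm
    have h2 := lintegral_map
      (μ := (gaussianReal 0 (v / 2)).prod (gaussianReal 0 (w / 2)))
      (f := fun x : ℝ => ENNReal.ofReal (Real.exp (-(s * x ^ 2))))
      (g := fun q : ℝ × ℝ => c * q.1 + d * q.2) (by fun_prop) (by fun_prop)
    rw [h1, ← h2, map_linear_prod_gaussianReal, lintegral_exp_neg_sq_gaussianReal hs]
    congr 3
    push_cast
    ring
  rw [lintegral_prod _ hFm.aemeasurable]
  rw [lintegral_complexGaussian v hFm.lintegral_prod_right']
  simp_rw [hinner]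
  rw [lintegral_prod_mul hJm.aemeasurable hJm.aemeasurable, hJint,
    ← ENNReal.ofReal_mul (by positivity)]
  congr 1
  rw [div_mul_div_comm, one_mul, Real.mul_self_sqrt (by positivity)]

/-- Laplace transform of the power received from a transmitter at `x`. -/
lemma lintegral_expNeg_power (par : Params) {s : ℝ} (hs : 0 ≤ s) {x : Plane} (hx : x ≠ 0) :
    ∫⁻ y, expNeg (ENNReal.ofReal s * power par (fun x _ => ‖x‖) x y)
        ∂(markLaw par.p (complexGaussian par.N)) =
      ENNReal.ofReal (par.p * (1 / (1 + par.e1 * s * ‖x‖ ^ (-par.α))) +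
        (1 - par.p) * (1 / (1 + par.Cd * s * ‖x‖ ^ (-par.α)))) := by
  have := isProbabilityMeasure_coin par.p_nonneg par.p_le_one
  have hp0 := par.p_nonneg
  have hp1 := par.p_le_one
  have hCd := par.Cd_pos
  have hCr := par.Cr_pos
  have hd0 := par.d0_pos
  have hr : 0 < ‖x‖ := norm_pos_iff.2 hx
  have hG := etaG_nonneg par hr.le
  have hH := etaH_nonneg par hr.le
  have he1 : 0 ≤ par.e1 := by unfold Params.e1; positivity
  have hpm : Measurable fun y => expNeg (ENNReal.ofReal s * power par (fun x _ => ‖x‖) x y) :=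
    measurable_expNeg.comp (measurable_const.mul ((measurable_power par
      (D := fun x _ => ‖x‖) (measurable_norm.comp measurable_fst)).comp measurable_prodMk_left))
  unfold markLaw
  rw [lintegral_prod _ hpm.aemeasurable, coin, lintegral_add_measure, lintegral_smul_measure,
    lintegral_smul_measure, lintegral_dirac, lintegral_dirac]
  have h1 : ∫⁻ y, expNeg (ENNReal.ofReal s * power par (fun x _ => ‖x‖) x (true, y))
      ∂(uniformAngle.prod ((complexGaussian 1).prod (complexGaussian par.N))) =
      ENNReal.ofReal (1 / (1 + par.e1 * s * ‖x‖ ^ (-par.α))) := by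
    refine (measurePreserving_snd.lintegral_comp (f := fun q : ℂ × ℂ => expNeg (ENNReal.ofReal s *
      ENNReal.ofReal (‖(Real.sqrt (par.etaG ‖x‖) : ℂ) * q.1 +
        (Real.sqrt (par.etaH ‖x‖) : ℂ) * q.2‖ ^ 2))) (by fun_prop)).trans ?_
    rw [lintegral_expNeg_norm_sq_complexGaussian hs, Real.sq_sqrt hG, Real.sq_sqrt hH]
    congr 3
    unfold Params.etaG Params.etaH Params.e1
    rw [Real.mul_rpow hd0.le hr.le]
    push_cast; ring
  have h2 : ∫⁻ y, expNeg (ENNReal.ofReal s * power par (fun x _ => ‖x‖) x (false, y))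
      ∂(uniformAngle.prod ((complexGaussian 1).prod (complexGaussian par.N))) =
      ENNReal.ofReal (1 / (1 + par.Cd * s * ‖x‖ ^ (-par.α))) := by
    -- No surface is the case of reflected coefficient `0`.
    have h3 := lintegral_expNeg_norm_sq_complexGaussian hs (Real.sqrt (par.etaG ‖x‖)) 0 1 par.N
    simp only [Complex.ofReal_zero, zero_mul, add_zero] at h3
    refine (measurePreserving_snd.lintegral_comp (f := fun q : ℂ × ℂ => expNeg (ENNReal.ofReal s *
      ENNReal.ofReal (‖(Real.sqrt (par.etaG ‖x‖) : ℂ) * q.1‖ ^ 2))) (by fun_prop)).trans ?_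
    rw [h3, Real.sq_sqrt hG]
    congr 3
    unfold Params.etaG
    push_cast; ring
  rw [h1, h2, smul_eq_mul, smul_eq_mul, ← ENNReal.ofReal_mul hp0,
    ← ENNReal.ofReal_mul (by linarith), ← ENNReal.ofReal_add (by positivity)]
  exact mul_nonneg (by linarith) (by positivity)

lemma sin_two_pi_div_pos {α : ℝ} (hα : 2 < α) : 0 < Real.sin (2 * Real.pi / α) := by
  have := Real.pi_pos
  refine Real.sin_pos_of_pos_of_lt_pi (by positivity) ?_
  rw [div_lt_iff₀ (by linarith)]
  nlinarith

/-- Write `c / (y^α + c)` as `∫ c e^{-(y^α + c) u} du` and swap. The `y`-integral yields `Γ(2/α)`,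
the `u`-integral `Γ(1 - 2/α)`; as `0 < 2/α < 1`, both are finite and the reflection formula applies.
-/
lemma lintegral_mul_div_rpow_add {α c : ℝ} (hα : 2 < α) (hc : 0 < c) :
    ∫⁻ y in Set.Ioi (0 : ℝ), ENNReal.ofReal (y * (c / (y ^ α + c))) =
      ENNReal.ofReal (Real.pi * (Real.sin (2 * Real.pi / α))⁻¹ * c ^ (2 / α) / α) := by
  have hα0 : 0 < α := by linarith
  have hδ1 : 2 / α < 1 := by rw [div_lt_one hα0]; exact hα
  have hδ0 : 0 < 2 / α := by positivity
  have hG1 := Real.Gamma_pos_of_pos hδ0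
  have hG2 := Real.Gamma_pos_of_pos (show 0 < 1 - 2 / α by linarith)
  have h1 : ∀ y ∈ Set.Ioi (0 : ℝ), ENNReal.ofReal (y * (c / (y ^ α + c))) =
      ∫⁻ u in Set.Ioi (0 : ℝ), ENNReal.ofReal (y * c * Real.exp (-((y ^ α + c) * u))) := by
    intro y hy
    have hy : 0 < y := hy
    symm
    have hi := Real.integral_rpow_mul_exp_neg_mul_Ioi (a := 1) (r := y ^ α + c) one_pos
      (by positivity)
    simp only [sub_self, Real.rpow_zero, one_mul, Real.rpow_one, Real.Gamma_one, mul_one] at hi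
    refine lintegral_ofReal_eq_of_integral_eq (by positivity)
      (.of_forall fun u => by positivity) ?_
    rw [integral_const_mul, hi]
    ring
  rw [setLIntegral_congr_fun measurableSet_Ioi h1, lintegral_lintegral_swap
    (by unfold Function.uncurry; fun_prop)]
  have h2 : ∀ u ∈ Set.Ioi (0 : ℝ),
      ∫⁻ y in Set.Ioi (0 : ℝ), ENNReal.ofReal (y * c * Real.exp (-((y ^ α + c) * u))) =
      ENNReal.ofReal (c * (1 / α) * Real.Gamma (2 / α) *
        (u ^ ((1 - 2 / α) - 1) * Real.exp (-(c * u)))) := by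
    intro u hu
    have hu : 0 < u := hu
    have hi := integral_rpow_mul_exp_neg_mul_rpow (p := α) (q := 1) (b := u) hα0 (by norm_num) hu
    refine lintegral_ofReal_eq_of_integral_eq (by positivity) ?_ ?_
    · filter_upwards [ae_restrict_mem measurableSet_Ioi] with y hy
      have : (0 : ℝ) < y := hy
      positivity
    · have h3 : ∀ y : ℝ, y * c * Real.exp (-((y ^ α + c) * u)) =
          c * Real.exp (-(c * u)) * (y ^ (1 : ℝ) * Real.exp (-u * y ^ α)) := by
        intro y
        rw [show -((y ^ α + c) * u) = -(c * u) + -u * y ^ α by ring, Real.exp_add, Real.rpow_one]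
        ring
      simp_rw [h3]
      rw [integral_const_mul, hi]
      rw [show -(1 + 1) / α = 1 - 2 / α - 1 by ring, show (1 + 1) / α = 2 / α by ring]
      ring
  rw [setLIntegral_congr_fun measurableSet_Ioi h2]
  have hs := sin_two_pi_div_pos hα
  have := Real.pi_pos
  refine lintegral_ofReal_eq_of_integral_eq (by positivity) ?_ ?_
  · filter_upwards [ae_restrict_mem measurableSet_Ioi] with y hy
    have : (0 : ℝ) < y := hy
    positivity
  · rw [integral_const_mul, Real.integral_rpow_mul_exp_neg_mul_Ioi (by linarith) hc]
    have hR := Real.Gamma_mul_Gamma_one_sub (2 / α)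
    have hcp : c * (1 / c) ^ (1 - 2 / α) = c ^ (2 / α) := by
      rw [one_div, Real.inv_rpow hc.le, ← Real.rpow_neg hc.le]
      nth_rw 1 [← Real.rpow_one c]
      rw [← Real.rpow_add hc]
      congr 1; ring
    rw [show Real.pi * (2 / α) = 2 * Real.pi / α by ring] at hR
    calc _ = (c * (1 / c) ^ (1 - 2 / α)) * (Real.Gamma (2 / α) * Real.Gamma (1 - 2 / α)) / α := by
          ring
      _ = _ := by rw [hcp, hR]; ring

/-- Polar coordinates: the factor `2π` is the dimension times the area of the unit disc. -/
lemma lintegral_div_norm_rpow_add {α c : ℝ} (hα : 2 < α) (hc : 0 ≤ c) :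
    ∫⁻ x : Plane, ENNReal.ofReal (c / (‖x‖ ^ α + c)) =
      ENNReal.ofReal (2 * Real.pi ^ 2 * (Real.sin (2 * Real.pi / α))⁻¹ * c ^ (2 / α) / α) := by
  have hα0 : 0 < α := by linarith
  rcases hc.eq_or_lt with rfl | hc
  · simp [Real.zero_rpow (show 2 / α ≠ 0 by positivity)]
  have hs := sin_two_pi_div_pos hα
  have hpi := Real.pi_pos
  have h1 := lintegral_mul_div_rpow_add hα hc
  have hnn : 0 ≤ᵐ[volume.restrict (Set.Ioi (0 : ℝ))] fun y => y * (c / (y ^ α + c)) := by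
    filter_upwards [ae_restrict_mem measurableSet_Ioi] with y hy
    have : (0 : ℝ) < y := hy
    positivity
  have h2 : ∫ y in Set.Ioi (0 : ℝ), y * (c / (y ^ α + c)) =
      Real.pi * (Real.sin (2 * Real.pi / α))⁻¹ * c ^ (2 / α) / α := by
    rw [integral_eq_lintegral_of_nonneg_ae hnn (by fun_prop), h1,
      ENNReal.toReal_ofReal (by positivity)]
  refine lintegral_ofReal_eq_of_integral_eq (by positivity)
    (.of_forall fun x => by positivity) ?_
  have h3 := integral_fun_norm_addHaar (volume : Measure Plane) (fun y => c / (y ^ α + c))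
  have h4 : (volume : Measure Plane).real (Metric.ball 0 1) = Real.pi := by
    rw [measureReal_def, EuclideanSpace.volume_ball_fin_two]
    simp [hpi.le]
  rw [h3, h4]
  simp only [finrank_euclideanSpace, Fintype.card_fin, Nat.add_one_sub_one, pow_one, smul_eq_mul,
    nsmul_eq_mul]
  rw [h2]
  push_cast; ring

/-- The exponent of the Laplace transform of the interference. -/
lemma lintegral_one_sub_power (par : Params) {s : ℝ} (hs : 0 ≤ s) :
    ∫⁻ x, (1 - ∫⁻ y, expNeg (ENNReal.ofReal s * power par (fun x _ => ‖x‖) x y)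
        ∂(markLaw par.p (complexGaussian par.N))) =
      ENNReal.ofReal (2 * Real.pi ^ 2 * (Real.sin (2 * Real.pi / par.α))⁻¹ / par.α *
        (par.p * (par.e1 * s) ^ (2 / par.α) + (1 - par.p) * (par.Cd * s) ^ (2 / par.α))) := by
  have hp0 := par.p_nonneg
  have hp1 : 0 ≤ 1 - par.p := by linarith [par.p_le_one]
  have hCd := par.Cd_pos
  have hCr := par.Cr_pos
  have hd0 := par.d0_pos
  have hα := par.two_lt_α
  have hα0 : 0 < par.α := by linarith
  have hsin := sin_two_pi_div_pos hα
  have he1 : 0 ≤ par.e1 := by unfold Params.e1; positivity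
  have h1 : ∀ᵐ x : Plane, 1 - ∫⁻ y, expNeg (ENNReal.ofReal s * power par (fun x _ => ‖x‖) x y)
        ∂(markLaw par.p (complexGaussian par.N)) =
      ENNReal.ofReal par.p * ENNReal.ofReal (par.e1 * s / (‖x‖ ^ par.α + par.e1 * s)) +
      ENNReal.ofReal (1 - par.p) * ENNReal.ofReal (par.Cd * s / (‖x‖ ^ par.α + par.Cd * s)) := by
    -- The origin is excluded because there `0 ^ (-α) = 0` by convention, which breaks the identity
    -- `1 - 1/(1 + c r^{-α}) = c/(r^α + c)`.
    filter_upwards [compl_mem_ae_iff.2 (measure_singleton (0 : Plane))] with x hx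
    have hx0 : x ≠ 0 := hx
    have hr : 0 < ‖x‖ := norm_pos_iff.2 hx0
    have hrp : 0 < ‖x‖ ^ par.α := Real.rpow_pos_of_pos hr _
    rw [lintegral_expNeg_power par hs hx0, ← ENNReal.ofReal_one,
      ← ENNReal.ofReal_sub _ (by rw [Real.rpow_neg hr.le]; positivity),
      ← ENNReal.ofReal_mul hp0, ← ENNReal.ofReal_mul hp1,
      ← ENNReal.ofReal_add (by positivity) (by positivity)]
    congr 1
    rw [Real.rpow_neg hr.le]
    field_simp
    ring
  rw [lintegral_congr_ae h1, lintegral_add_left (by fun_prop), lintegral_const_mul _ (by fun_prop),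
    lintegral_const_mul _ (by fun_prop), lintegral_div_norm_rpow_add hα (by positivity),
    lintegral_div_norm_rpow_add hα (by positivity), ← ENNReal.ofReal_mul hp0,
    ← ENNReal.ofReal_mul hp1, ← ENNReal.ofReal_add (by positivity) (by positivity)]
  congr 1
  ring

namespace Network

variable {par : Params} {lam : ℝ} {Ω : Type*} [MeasurableSpace Ω] {μ : Measure Ω}
  [IsProbabilityMeasure μ] (W : Network par lam (complexGaussian par.N) μ)

lemma ae_interference_distTX_lt_top (hlam : 0 ≤ lam) :
    ∀ᵐ ω ∂μ, W.interference W.distTX ω < ⊤ :=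
  W.ae_interference_lt_top hlam (D := fun x _ => ‖x‖) (measurable_norm.comp measurable_fst)
    (fun x _ => by linarith [par.d0_pos]) (lintegral_norm_sq_complexGaussian_lt_top _)
    fun _ _ => rfl

lemma coverage_distTX_eq_laplace (hlam : 0 ≤ lam) {t : ℝ} (ht : 0 ≤ t) :
    W.coverage W.distTX t =
      Real.exp (-(t * par.gammaT⁻¹ / par.etaG0)) * W.laplace W.distTX (t / par.etaG0) :=
  W.coverage_eq (D := fun x _ => ‖x‖) (measurable_norm.comp measurable_fst) (fun _ _ => rfl)
    (W.ae_interference_distTX_lt_top hlam) ht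

theorem coverage_distTX_closed_form (hlam : 0 ≤ lam) {t : ℝ} (ht : 0 ≤ t) :
    W.coverage W.distTX t =
      Real.exp (-(t / par.etaG0 * par.gammaT⁻¹)
        - 2 * Real.pi ^ 2 * lam * par.p * (Real.sin (2 * Real.pi / par.α))⁻¹
            * (par.e1 * t / par.etaG0) ^ (2 / par.α) / par.α
        - 2 * Real.pi ^ 2 * lam * (1 - par.p) * (Real.sin (2 * Real.pi / par.α))⁻¹
            * (par.Cd * t / par.etaG0) ^ (2 / par.α) / par.α) := by
  have hη : 0 < par.etaG0 :=
    mul_pos par.Cd_pos (Real.rpow_pos_of_pos (norm_pos_iff.2 par.x0_ne_zero) _)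
  have hs : 0 ≤ t / par.etaG0 := by positivity
  have hp0 := par.p_nonneg
  have hp1 : 0 ≤ 1 - par.p := by linarith [par.p_le_one]
  have hCd := par.Cd_pos
  have hCr := par.Cr_pos
  have hd0 := par.d0_pos
  have hα0 : 0 < par.α := by linarith [par.two_lt_α]
  have hsin := sin_two_pi_div_pos par.two_lt_α
  have he1 : 0 ≤ par.e1 := by unfold Params.e1; positivity
  have hDm : Measurable (Function.uncurry fun (x : Plane) (_ : ℝ) => ‖x‖) :=
    measurable_norm.comp measurable_fst
  have hL : ENNReal.ofReal (W.laplace W.distTX (t / par.etaG0)) = _ :=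
    W.laplace_eq_lintegral (W.measurable_interference hDm fun _ _ => rfl)
    (W.ae_interference_distTX_lt_top hlam) hs
  rw [W.lintegral_expNeg_interference hlam hDm (fun _ _ => rfl), lintegral_one_sub_power par hs,
    ← ENNReal.ofReal_mul hlam, expNeg_ofReal (by positivity),
    ENNReal.ofReal_eq_ofReal_iff (show 0 ≤ W.laplace W.distTX _ from
      integral_nonneg fun _ => (Real.exp_pos _).le) (Real.exp_pos _).le] at hL
  rw [W.coverage_distTX_eq_laplace hlam ht, hL, ← Real.exp_add, ← mul_div_assoc, ← mul_div_assoc]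
  congr 1
  ring

theorem coverage_distTX_lt {lam' : ℝ} (hlam : 0 ≤ lam) (hlt : lam < lam') {t : ℝ} (ht : 0 < t)
    {Ω' : Type*} [MeasurableSpace Ω'] {μ' : Measure Ω'} [IsProbabilityMeasure μ']
    (W' : Network par lam' (complexGaussian par.N) μ') :
    W'.coverage W'.distTX t < W.coverage W.distTX t := by
  have hη : 0 < par.etaG0 :=
    mul_pos par.Cd_pos (Real.rpow_pos_of_pos (norm_pos_iff.2 par.x0_ne_zero) _)
  have hp0 := par.p_nonneg
  have hp1 : 0 ≤ 1 - par.p := by linarith [par.p_le_one]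
  have hCd := par.Cd_pos
  have hCr := par.Cr_pos
  have hd0 := par.d0_pos
  have hpi := Real.pi_pos
  have hα0 : 0 < par.α := by linarith [par.two_lt_α]
  have hsin := sin_two_pi_div_pos par.two_lt_α
  have he1 : 0 < par.e1 := by unfold Params.e1; positivity
  rw [W.coverage_distTX_closed_form hlam ht.le,
    W'.coverage_distTX_closed_form (hlam.trans hlt.le) ht.le, Real.exp_lt_exp]
  set A := (par.e1 * t / par.etaG0) ^ (2 / par.α) with hA
  set B := (par.Cd * t / par.etaG0) ^ (2 / par.α) with hB
  have hA0 : 0 < A := by positivity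
  have hB0 : 0 < B := by positivity
  set K := 2 * Real.pi ^ 2 * (Real.sin (2 * Real.pi / par.α))⁻¹ / par.α with hK
  have hK0 : 0 < K := by positivity
  -- At `p = 0` the slope of the exponent comes from `B` alone.
  have hAB : 0 < par.p * A + (1 - par.p) * B := by
    rcases hp0.eq_or_lt with h | h
    · rw [← h]; simpa using hB0
    · positivity
  have h := mul_lt_mul_of_pos_right hlt (mul_pos hK0 hAB)
  have hexp : ∀ l : ℝ, 2 * Real.pi ^ 2 * l * par.p * (Real.sin (2 * Real.pi / par.α))⁻¹ * A / par.α +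
      2 * Real.pi ^ 2 * l * (1 - par.p) * (Real.sin (2 * Real.pi / par.α))⁻¹ * B / par.α =
      l * (K * (par.p * A + (1 - par.p) * B)) := by
    intro l; rw [hK]; ring
  linarith [hexp lam, hexp lam']

end Network

/-! ### Actual geometry of the surfaces, and conclusion. -/

/-- Distance from the user to the surface seen from a transmitter at `x` in direction `ψ`. -/
noncomputable def surfaceDist (d0 : ℝ) (x : Plane) (ψ : ℝ) : ℝ :=
  ‖x + d0 • !₂[Real.cos ψ, Real.sin ψ]‖

lemma measurable_surfaceDist (d0 : ℝ) : Measurable (Function.uncurry (surfaceDist d0)) := by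
  unfold surfaceDist Function.uncurry
  refine Continuous.measurable ?_
  fun_prop

/-- Besides measurability, the only property of the geometry used for the finiteness of `I`. -/
lemma norm_sub_le_surfaceDist {d0 : ℝ} (hd0 : 0 ≤ d0) (x : Plane) (ψ : ℝ) :
    ‖x‖ - d0 ≤ surfaceDist d0 x ψ := by
  have h1 : ‖d0 • (!₂[Real.cos ψ, Real.sin ψ] : Plane)‖ = d0 := by
    rw [norm_smul, EuclideanSpace.norm_eq]
    simp [abs_of_nonneg hd0]
  have := norm_sub_le (x + d0 • (!₂[Real.cos ψ, Real.sin ψ] : Plane))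
    (d0 • (!₂[Real.cos ψ, Real.sin ψ] : Plane))
  rw [add_sub_cancel_right, h1] at this
  unfold surfaceDist
  linarith

lemma isProbabilityMeasure_reflectedLaw (N : ℕ) {mh mr : ℝ} (hmh : 0 < mh) (hmr : 0 < mr) :
    IsProbabilityMeasure (reflectedLaw N mh mr) := by
  have := isProbabilityMeasure_nakagami hmh
  have := isProbabilityMeasure_nakagami hmr
  exact Measure.isProbabilityMeasure_map (by fun_prop)

end RIS

theorem proposition4 (par : RIS.Params) (lam : ℝ) (hlam : 0 < lam) (t : ℝ) (ht : 0 ≤ t) :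
    -- factorization, with the actual fading and geometry of the surfaces
    (∀ (Ω : Type*) [MeasurableSpace Ω] (μ : MeasureTheory.Measure Ω)
        [MeasureTheory.IsProbabilityMeasure μ]
        (W : RIS.Network par lam (RIS.reflectedLaw par.N par.mh par.mr) μ),
      (∀ᵐ ω ∂μ, W.interference W.distRIS ω < ⊤) ∧
      W.coverage W.distRIS t =
        Real.exp (-(t * par.gammaT⁻¹ / par.etaG0)) * W.laplace W.distRIS (t / par.etaG0)) ∧
    -- factorization and closed form, with CN(0, N) reflected fading and RIS-user distances
    -- replaced by TX-user distances
    (∀ (Ω : Type*) [MeasurableSpace Ω] (μ : MeasureTheory.Measure Ω)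
        [MeasureTheory.IsProbabilityMeasure μ]
        (W : RIS.Network par lam (RIS.complexGaussian par.N) μ),
      (∀ᵐ ω ∂μ, W.interference W.distTX ω < ⊤) ∧
      W.coverage W.distTX t =
        Real.exp (-(t * par.gammaT⁻¹ / par.etaG0)) * W.laplace W.distTX (t / par.etaG0) ∧
      W.coverage W.distTX t =
        Real.exp (-(t / par.etaG0 * par.gammaT⁻¹)
          - 2 * Real.pi ^ 2 * lam * par.p * (Real.sin (2 * Real.pi / par.α))⁻¹
              * (par.e1 * t / par.etaG0) ^ (2 / par.α) / par.α
          - 2 * Real.pi ^ 2 * lam * (1 - par.p) * (Real.sin (2 * Real.pi / par.α))⁻¹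
              * (par.Cd * t / par.etaG0) ^ (2 / par.α) / par.α)) ∧
    -- the coverage probability strictly decreases when the density of TXs increases
    (∀ (lam' : ℝ), lam < lam' → 0 < t →
      ∀ (Ω : Type*) [MeasurableSpace Ω] (μ : MeasureTheory.Measure Ω)
        [MeasureTheory.IsProbabilityMeasure μ]
        (Ω' : Type*) [MeasurableSpace Ω'] (μ' : MeasureTheory.Measure Ω')
        [MeasureTheory.IsProbabilityMeasure μ']
        (W : RIS.Network par lam (RIS.complexGaussian par.N) μ)
        (W' : RIS.Network par lam' (RIS.complexGaussian par.N) μ'),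
      W'.coverage W'.distTX t < W.coverage W.distTX t) := by
  refine ⟨fun Ω _ μ _ W => ?_, fun Ω _ μ _ W => ?_, fun lam' hlt ht' Ω _ μ _ Ω' _ μ' _ W W' => ?_⟩
  · have := RIS.isProbabilityMeasure_reflectedLaw par.N par.mh_pos par.mr_pos
    have hfin : ∀ᵐ ω ∂μ, W.interference W.distRIS ω < ⊤ :=
      W.ae_interference_lt_top hlam.le (RIS.measurable_surfaceDist par.d0)
        (RIS.norm_sub_le_surfaceDist par.d0_pos.le)
        (RIS.lintegral_norm_sq_reflectedLaw_lt_top par.N par.mh_pos par.mr_pos) fun _ _ => rfl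
    exact ⟨hfin, W.coverage_eq (RIS.measurable_surfaceDist par.d0) (fun _ _ => rfl) hfin ht⟩
  · exact ⟨W.ae_interference_distTX_lt_top hlam.le, W.coverage_distTX_eq_laplace hlam.le ht,
      W.coverage_distTX_closed_form hlam.le ht⟩
  · exact W.coverage_distTX_lt hlam.le hlt ht' W'
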